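/- Let $n\ge 1$ and let $\Omega\subset\mathbb R^n$ be a bounded polyhedral Lipschitz domain. Let $Lv=-A:\mathrm D^2v+b\cdot\nabla v+c\,v$, where $A\in C(\overline\Omega;\mathbb R^{n\times n})$ is symmetric with $\lambda I_n\le A\le\Lambda I_n$ for constants $0<\lambda\le\Lambda$, $b\in L^\infty(\Omega;\mathbb R^n)$ and $0\le c\in L^\infty(\Omega)$. Fix $\alpha>0$. Let $(\mathcal T_j)_{j}$ be a quasi-uniform sequence of regular triangulations of $\Omega$ into closed simplices or rectangles whose maximal mesh-sizes tend to $0$. For each $j$, let $V(\mathcal T_j)\subset W^{2,\infty}(\Omega)$ be a finite-dimensional ($C^1$ conforming finite element) space and $\mathcal L_{j,b}\subset\partial\Omega$ a closed (for instance finite) set of points. Assume that for every $v\in W^{2,n}(\Omega)$ there are $v_j\in V(\mathcal T_j)$ with $\|v-v_j\|_{W^{2,n}(\Omega)}\to0$, and that $\|v_j\|_{L^\infty(F)}\le C_b\max_{z\in\mathcal L_{j,b}\cap F}|v_j(z)|$ for all $j$, all $v_j\in V(\mathcal T_j)$ and all boundary sides $F$ of $\mathcal T_j$, with a constant $C_b$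 independent of $j$. Let $f\in L^n(\Omega)$ and $g\in C(\partial\Omega)$, and suppose that the boundary data are exact: for every $j$ there is $g_j\in V(\mathcal T_j)$ with $g_j=g$ on $\partial\Omega$. Let $u\in C(\overline\Omega)\cap W^{2,n}_{\mathrm{loc}}(\Omega)$ be the strong solution to $Lu=f$ in $\Omega$, $u=g$ on $\partial\Omega$, and suppose that $u\in W^{2,n}(\Omega)$. For each $j$, let $(u_j,t_j)$ minimize $$\Psi(v_j,t):=\alpha t^n+\|f-Lv_j\|_{L^n(\Omega)}^n$$ among all $(v_j,t)\in V(\mathcal T_j)\times[0,\infty)$ with $-t\le g_j(z)-v_j(z)\le t$ for all $z\in\mathcal L_{j,b}$, and let $$\widetilde\Psi(v_j;g):=\alpha\max_{z\in\mathcal L_{j,b}}|g(z)-v_j(z)|^n+\|f-Lv_j\|_{L^n(\Omega)}^n .$$ Then there is a constant $C>0$ that depends only on $n$, $\Omega$, $A$, $b$, $c$ and $\alpha$ (in particular, neither on $j$ and the discretization nor on $f$, $g$, $u$) such that, for every $j$, $$\Psi(u_j,t_j)=\widetilde\Psi(u_j;g)\le C\min_{v_j\in V(\mathcal T_j)}\|u-v_j\|_{W^{2,n}(\Omega)}^n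 ,$$ where the minimum on the right-hand side is attained. Here $\|v\|_{W^{2,n}(\Omega)}^n=\|v\|_{L^n(\Omega)}^n+\|\nabla v\|_{L^n(\Omega)}^n+\|\mathrm D^2v\|_{L^n(\Omega)}^n$, and functions in $V(\mathcal T_j)$ are identified with their representatives that are continuous on $\overline\Omega$. -/

import Mathlib

open MeasureTheory Set Filter Topology
open scoped ENNReal NNReal ContDiff InnerProductSpace

namespace NondivFEM

/-- Euclidean space of dimension `n`. -/
abbrev E (n : ℕ) : Type := EuclideanSpace ℝ (Fin n)

/-! ## Sobolev spaces -/

/-- `w` is the weak (distributional) partial derivative `∂ᵢ u` in the open set `Ω`. -/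
def IsWeakPartial {n : ℕ} (Ω : Set (E n)) (i : Fin n) (u w : E n → ℝ) : Prop :=
  LocallyIntegrableOn u Ω ∧ LocallyIntegrableOn w Ω ∧
    ∀ φ : E n → ℝ, ContDiff ℝ ∞ φ → HasCompactSupport φ → tsupport φ ⊆ Ω →
      ∫ x in Ω, u x * fderiv ℝ φ x (EuclideanSpace.single i 1) = -∫ x in Ω, w x * φ x

open scoped Classical in
/-- A representative of the weak partial derivative `∂ᵢ u` in `Ω` (unique almost everywhere in
`Ω`), with the junk value `0` if there is none. -/
noncomputable def weakPartial {n : ℕ} (Ω : Set (E n)) (i : Fin n) (u : E n → ℝ) : E n → ℝ :=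
  if h : ∃ w, IsWeakPartial Ω i u w then h.choose else 0

/-- The weak gradient. -/
noncomputable def weakGrad {n : ℕ} (Ω : Set (E n)) (u : E n → ℝ) (x : E n) : E n :=
  WithLp.toLp 2 fun i => weakPartial Ω i u x

/-- The weak Hessian. -/
noncomputable def weakHess {n : ℕ} (Ω : Set (E n)) (u : E n → ℝ) (x : E n) :
    Matrix (Fin n) (Fin n) ℝ :=
  Matrix.of fun i j => weakPartial Ω i (weakPartial Ω j u) x

/-- The Frobenius norm of a matrix. -/
noncomputable def frobenius {n : ℕ} (M : Matrix (Fin n) (Fin n) ℝ) : ℝ :=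
  Real.sqrt (∑ i, ∑ j, M i j ^ 2)

/-- All weak partial derivatives of `u` in `Ω` of first and second order exist
(as locally integrable functions). -/
def HasWeakDerivs2 {n : ℕ} (Ω : Set (E n)) (u : E n → ℝ) : Prop :=
  ∀ i, (∃ w, IsWeakPartial Ω i u w) ∧ ∀ j, ∃ w, IsWeakPartial Ω j (weakPartial Ω i u) w

/-- `u` and its weak partial derivatives in `Ω` of first and second order are `p`-integrable
over `S ⊆ Ω`. -/
def DerivsMemLp2 {n : ℕ} (Ω : Set (E n)) (p : ℝ≥0∞) (S : Set (E n)) (u : E n → ℝ) : Prop :=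
  MemLp u p (volume.restrict S) ∧ (∀ i, MemLp (weakPartial Ω i u) p (volume.restrict S)) ∧
    ∀ i j, MemLp (weakPartial Ω j (weakPartial Ω i u)) p (volume.restrict S)

/-- `u ∈ W^{2,p}(Ω)`. -/
def MemW2 {n : ℕ} (Ω : Set (E n)) (p : ℝ≥0∞) (u : E n → ℝ) : Prop :=
  HasWeakDerivs2 Ω u ∧ DerivsMemLp2 Ω p Ω u

/-- `u ∈ W^{2,p}_loc(Ω)`. -/
def MemW2Loc {n : ℕ} (Ω : Set (E n)) (p : ℝ≥0∞) (u : E n → ℝ) : Prop :=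
  HasWeakDerivs2 Ω u ∧ ∀ K ⊆ Ω, IsCompact K → DerivsMemLp2 Ω p K u

/-- The Sobolev norm
`‖u‖_{W^{2,p}(Ω)} = (‖u‖_{L^p}^p + ‖∇u‖_{L^p}^p + ‖D²u‖_{L^p}^p)^{1/p}`, for an integer `p ≥ 1`. -/
noncomputable def normW2 {n : ℕ} (Ω : Set (E n)) (p : ℕ) (u : E n → ℝ) : ℝ :=
  (lpNorm u p (volume.restrict Ω) ^ p
    + lpNorm (weakGrad Ω u) p (volume.restrict Ω) ^ p
    + lpNorm (fun x => frobenius (weakHess Ω u x)) p (volume.restrict Ω) ^ p) ^ (1 / (p : ℝ))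

/-! ## Domains -/

/-- Bounded open sets with Lipschitz boundary: near every boundary point, in a suitable Cartesian
coordinate system with last axis `ν`, the set is the part above the graph of a Lipschitz function
of the remaining coordinates. (Connectedness is not needed.) -/
structure IsBoundedLipschitz {n : ℕ} (Ω : Set (E n)) : Prop where
  isOpen : IsOpen Ω
  isBounded : Bornology.IsBounded Ω
  lipschitz_boundary : ∀ x₀ ∈ frontier Ω, ∃ r > (0 : ℝ), ∃ ν : E n, ‖ν‖ = 1 ∧
    ∃ (K : ℝ≥0) (γ : E n → ℝ), LipschitzWith K γ ∧
      ∀ x ∈ Metric.ball x₀ r, x ∈ Ω ↔ γ (x - ⟪ν, x⟫_ℝ • ν) < ⟪ν, x⟫_ℝ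

/-- Closed nondegenerate `n`-simplices in `ℝⁿ`. -/
def IsClosedSimplex {n : ℕ} (T : Set (E n)) : Prop :=
  ∃ p : Fin (n + 1) → E n, AffineIndependent ℝ p ∧ T = convexHull ℝ (range p)

/-- Closed nondegenerate `n`-dimensional rectangles (in arbitrary position). -/
def IsClosedRectangle {n : ℕ} (T : Set (E n)) : Prop :=
  ∃ (Φ : E n ≃ᵃⁱ[ℝ] E n) (ℓ : Fin n → ℝ), (∀ i, 0 < ℓ i) ∧
    T = Φ '' {x : E n | ∀ i, 0 ≤ x i ∧ x i ≤ ℓ i}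

/-- `Ω` is polyhedral: its closure is a finite union of closed `n`-simplices. -/
def IsPolyhedral {n : ℕ} (Ω : Set (E n)) : Prop :=
  ∃ 𝒮 : Finset (Set (E n)), (∀ T ∈ 𝒮, IsClosedSimplex T) ∧ ⋃ T ∈ 𝒮, T = closure Ω

/-! ## Triangulations -/

/-- Regular (i.e. without hanging nodes) triangulations of `Ω` into closed simplices or
rectangles: any two cells intersect in a common face. (The faces of a convex polytope, including
the empty face and the polytope itself, are its exposed subsets.) -/
structure IsTriangulation {n : ℕ} (Ω : Set (E n)) (𝒯 : Finset (Set (E n))) : Prop where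
  cell : ∀ T ∈ 𝒯, IsClosedSimplex T ∨ IsClosedRectangle T
  cover : ⋃ T ∈ 𝒯, T = closure Ω
  regular : ∀ T ∈ 𝒯, ∀ T' ∈ 𝒯, IsExposed ℝ T (T ∩ T') ∧ IsExposed ℝ T' (T ∩ T')

/-- The sides of a triangulation: the `(n-1)`-dimensional faces of its cells. -/
def sides {n : ℕ} (𝒯 : Finset (Set (E n))) : Set (Set (E n)) :=
  {F | F.Nonempty ∧ Module.finrank ℝ (vectorSpan ℝ F) + 1 = n ∧ ∃ T ∈ 𝒯, IsExposed ℝ T F}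

/-- The boundary sides. -/
def boundarySides {n : ℕ} (Ω : Set (E n)) (𝒯 : Finset (Set (E n))) : Set (Set (E n)) :=
  {F ∈ sides 𝒯 | F ⊆ frontier Ω}

/-- The maximal mesh-size, the maximum of the diameters of the cells. -/
noncomputable def meshSize {n : ℕ} (𝒯 : Finset (Set (E n))) : ℝ :=
  ⨆ T : 𝒯, Metric.diam (T : Set (E n))

/-- Quasi-uniformity of a sequence of triangulations: all cells contain a ball of radius
proportional to the maximal mesh-size, with a constant independent of the index. -/
def IsQuasiUniform {n : ℕ} (𝒯 : ℕ → Finset (Set (E n))) : Prop :=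
  ∃ κ > (0 : ℝ), ∀ j, ∀ T ∈ 𝒯 j, ∃ x, Metric.closedBall x (κ * meshSize (𝒯 j)) ⊆ T

/-- `sup_{z ∈ S} |w z|`, with value `0` for empty `S`. This is the maximum for nonempty
compact `S` and continuous `w`, and then also the `L^∞` norm of `w` on a side `S`. -/
noncomputable def supAbs {n : ℕ} (S : Set (E n)) (w : E n → ℝ) : ℝ :=
  ⨆ z : S, |w z|

/-- The discrete data of the conforming method: a quasi-uniform sequence of regular triangulations
with vanishing mesh-size, conforming (finite-dimensional) finite element spaces
`V j ⊆ W^{2,∞}(Ω)`, which approximate every function in `W^{2,n}(Ω)`, and sets of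
boundary points `L j` that control discrete functions on boundary sides. The discrete functions
are represented by functions that are continuous up to the boundary; their values outside of the
closure of `Ω` are irrelevant. (On a Lipschitz domain, such functions in `W^{2,∞}(Ω)` are
automatically `C¹` up to the boundary.) -/
structure ConformingSetting {n : ℕ} (Ω : Set (E n)) where
  /-- the triangulations -/
  𝒯 : ℕ → Finset (Set (E n))
  triangulation : ∀ j, IsTriangulation Ω (𝒯 j)
  quasiUniform : IsQuasiUniform 𝒯
  meshSize_tendsto : Tendsto (fun j => meshSize (𝒯 j)) atTop (𝓝 0)
  /-- the finite element spaces -/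
  V : ℕ → Submodule ℝ (E n → ℝ)
  finiteDimensional : ∀ j, FiniteDimensional ℝ (V j)
  continuousOn : ∀ j, ∀ v ∈ V j, ContinuousOn v (closure Ω)
  memW2 : ∀ j, ∀ v ∈ V j, MemW2 Ω ∞ v
  approximation : ∀ v : E n → ℝ, MemW2 Ω n v → ∃ w : ℕ → E n → ℝ, (∀ j, w j ∈ V j) ∧
    Tendsto (fun j => normW2 Ω n (v - w j)) atTop (𝓝 0)
  /-- the boundary points -/
  L : ℕ → Set (E n)
  L_subset : ∀ j, L j ⊆ frontier Ω
  L_closed : ∀ j, IsClosed (L j)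
  boundary_control : ∃ C : ℝ, ∀ j, ∀ v ∈ V j, ∀ F ∈ boundarySides Ω (𝒯 j),
    supAbs F v ≤ C * supAbs (L j ∩ F) v

/-! ## The differential equation -/

/-- The assumptions on the coefficients of the operator: `A` is continuous on the closure of `Ω`
with values in the symmetric matrices and `lam I ≤ A ≤ Lam I`, `b` and `c` are bounded, `c ≥ 0`. -/
structure IsAdmissible {n : ℕ} (Ω : Set (E n)) (lam Lam : ℝ)
    (A : E n → Matrix (Fin n) (Fin n) ℝ) (b : E n → E n) (c : E n → ℝ) : Prop where
  continuousOn : ContinuousOn A (closure Ω)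
  symm : ∀ x ∈ closure Ω, (A x).IsSymm
  lower : ∀ x ∈ closure Ω, (A x - lam • (1 : Matrix (Fin n) (Fin n) ℝ)).PosSemidef
  upper : ∀ x ∈ closure Ω, (Lam • (1 : Matrix (Fin n) (Fin n) ℝ) - A x).PosSemidef
  drift : MemLp b ∞ (volume.restrict Ω)
  reaction : MemLp c ∞ (volume.restrict Ω)
  reaction_nonneg : ∀ᵐ x ∂volume.restrict Ω, 0 ≤ c x

/-- The operator in nondivergence form, `L v = -A : D²v + b · ∇v + c v`. -/
noncomputable def opL {n : ℕ} (Ω : Set (E n)) (A : E n → Matrix (Fin n) (Fin n) ℝ)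
    (b : E n → E n) (c : E n → ℝ) (v : E n → ℝ) (x : E n) : ℝ :=
  -(∑ i, ∑ j, A x i j * weakHess Ω v x i j) + ⟪b x, weakGrad Ω v x⟫_ℝ + c x * v x

/-- Strong solutions `u ∈ C(closure Ω) ∩ W^{2,n}_loc(Ω)` to `L u = f` in `Ω`, `u = g` on `∂Ω`. -/
structure IsStrongSolution {n : ℕ} (Ω : Set (E n)) (A : E n → Matrix (Fin n) (Fin n) ℝ)
    (b : E n → E n) (c : E n → ℝ) (f g : E n → ℝ) (u : E n → ℝ) : Prop where
  continuousOn : ContinuousOn u (closure Ω)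
  memW2Loc : MemW2Loc Ω n u
  equation : ∀ᵐ x ∂volume.restrict Ω, opL Ω A b c u x = f x
  boundary : ∀ x ∈ frontier Ω, u x = g x

/-! ## The discrete minimization problem -/

/-- The admissible pairs: `v` in the discrete space `V` and `t ≥ 0` with
`-t ≤ g z - v z ≤ t` for all `z ∈ L`. -/
def admissibleSet {n : ℕ} (V : Submodule ℝ (E n → ℝ)) (L : Set (E n)) (g : E n → ℝ) :
    Set ((E n → ℝ) × ℝ) :=
  {q | q.1 ∈ V ∧ 0 ≤ q.2 ∧ ∀ z ∈ L, -q.2 ≤ g z - q.1 z ∧ g z - q.1 z ≤ q.2}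

/-- `Ψ(v, t) = α tⁿ + ‖f - L v‖ⁿ_{Lⁿ(Ω)}`. -/
noncomputable def Psi {n : ℕ} (Ω : Set (E n)) (A : E n → Matrix (Fin n) (Fin n) ℝ)
    (b : E n → E n) (c : E n → ℝ) (α : ℝ) (f : E n → ℝ) (q : (E n → ℝ) × ℝ) : ℝ :=
  α * q.2 ^ n + lpNorm (fun x => f x - opL Ω A b c q.1 x) n (volume.restrict Ω) ^ n

/-- `Ψ̃(v; g) = α max_{z ∈ L} |g z - v z|ⁿ + ‖f - L v‖ⁿ_{Lⁿ(Ω)}`. -/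
noncomputable def PsiTilde {n : ℕ} (Ω : Set (E n)) (A : E n → Matrix (Fin n) (Fin n) ℝ)
    (b : E n → E n) (c : E n → ℝ) (α : ℝ) (f : E n → ℝ) (L : Set (E n))
    (v g : E n → ℝ) : ℝ :=
  α * supAbs L (fun z => g z - v z) ^ n
    + lpNorm (fun x => f x - opL Ω A b c v x) n (volume.restrict Ω) ^ n

end NondivFEM

/-! The estimate is quasi-optimality by comparison. For any discrete `v`, the pair of `v` and its
maximal boundary error is admissible, so the minimum of `Psi` is at most its value there. Take `v`
to be a best approximation of `u`, which exists because the discrete space is finite-dimensional.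
Its residual is `f - L v = L (u - v)` almost everywhere, and `exists_lpNorm_opL_le` bounds this by
the Sobolev norm of `u - v`. Since the discrete data, `g` and `u` agree on the boundary, the
boundary error is the maximum of `|u - v|` over the boundary points, which `exists_abs_le_normW2`
bounds by the same norm.

The analytic core is this last bound, the embedding of `W^{2,n}` into bounded functions at boundary
points. Mollify `w` and restrict it to a ray `x + s • y` inside a cone in `Ω`. A representation
formula bounds the value at the vertex by the integral over `s` in `[0, 1]` of derivatives up to
order two, with weight `s`. Averaging over directions `y` in a ball `B` and rescaling, the `L¹` norm
over `B` of a function dilated by `s` costs `s⁻¹` times its `Lⁿ` norm. Weight and scaling factor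
cancel, so the bound is uniform in the mollification. The Lipschitz boundary supplies the cones,
with vertices tending to a given boundary point, and compactness makes the constant global. -/

namespace NondivFEM

/-! ### Calculus of weak derivatives, up to null sets -/

section WeakDerivatives

variable {n : ℕ} {Ω : Set (E n)} {i : Fin n} {u v w w' : E n → ℝ}

/-- The product of a locally integrable function with a continuous compactly supported one. -/
lemma integrableOn_mul_of_hasCompactSupport {ψ : E n → ℝ} (hu : LocallyIntegrableOn u Ω)
    (hψ : Continuous ψ) (hc : HasCompactSupport ψ) (hs : tsupport ψ ⊆ Ω) :
    IntegrableOn (fun x => u x * ψ x) Ω := by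
  have h1 : IntegrableOn (fun x => u x * ψ x) (tsupport ψ) :=
    (hu.integrableOn_compact_subset hs hc).mul_continuousOn hψ.continuousOn hc
  refine ((integrableOn_iff_integrable_of_support_subset ?_).1 h1).integrableOn
  intro x hx
  exact subset_tsupport _ (fun h => hx (by simp [h]))

lemma continuous_fderiv_apply_of_contDiff {φ : E n → ℝ} (hφ : ContDiff ℝ ∞ φ) (e : E n) :
    Continuous fun x => fderiv ℝ φ x e :=
  (hφ.continuous_fderiv (by simp)).clm_apply continuous_const

/-- The fundamental lemma of the calculus of variations, applied to `w - w'`. -/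
lemma IsWeakPartial.ae_unique (hΩ : IsOpen Ω) (h : IsWeakPartial Ω i u w)
    (h' : IsWeakPartial Ω i u w') : w =ᵐ[volume.restrict Ω] w' := by
  have key := hΩ.ae_eq_zero_of_integral_contDiff_smul_eq_zero (μ := volume)
    (f := fun x => w x - w' x) (h.2.1.sub h'.2.1) ?_
  · rw [EventuallyEq, ae_restrict_iff' hΩ.measurableSet]
    filter_upwards [key] with x hx hxΩ
    exact sub_eq_zero.1 (hx hxΩ)
  · intro φ hφ hc hs
    have e := (h.2.2 φ hφ hc hs).symm.trans (h'.2.2 φ hφ hc hs)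
    have e2 : ∫ x in Ω, φ x • (w x - w' x) = 0 := by
      have : ∀ x, φ x • (w x - w' x) = w x * φ x - w' x * φ x := fun x => by
        simp only [smul_eq_mul]; ring
      simp only [this]
      rw [integral_sub (integrableOn_mul_of_hasCompactSupport h.2.1 hφ.continuous hc hs)
        (integrableOn_mul_of_hasCompactSupport h'.2.1 hφ.continuous hc hs)]
      linarith
    rw [← e2, setIntegral_eq_integral_of_forall_compl_eq_zero]
    intro x hx
    rw [image_eq_zero_of_notMem_tsupport (fun h => hx (hs h)), zero_smul]

lemma locallyIntegrableOn_congr (hu : LocallyIntegrableOn u Ω)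
    (h : u =ᵐ[volume.restrict Ω] v) : LocallyIntegrableOn v Ω := by
  intro x hx
  obtain ⟨s, hs, hi⟩ := hu x hx
  refine ⟨s ∩ Ω, inter_mem hs self_mem_nhdsWithin, ?_⟩
  exact (hi.mono_set inter_subset_left).congr_fun_ae
    (ae_mono (Measure.restrict_mono inter_subset_right le_rfl) h)

/-- Second derivatives are taken of the arbitrarily chosen representative `weakPartial Ω i u`. This
lemma allows it to be exchanged for an explicit first derivative. -/
lemma IsWeakPartial.congr (h : IsWeakPartial Ω i u w)
    (hu : u =ᵐ[volume.restrict Ω] v) (hw : w =ᵐ[volume.restrict Ω] w') :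
    IsWeakPartial Ω i v w' := by
  refine ⟨locallyIntegrableOn_congr h.1 hu,
    locallyIntegrableOn_congr h.2.1 hw, fun φ hφ hc hs => ?_⟩
  have e1 : ∫ x in Ω, v x * fderiv ℝ φ x (EuclideanSpace.single i 1)
      = ∫ x in Ω, u x * fderiv ℝ φ x (EuclideanSpace.single i 1) :=
    integral_congr_ae (by filter_upwards [hu] with x hx; rw [hx])
  have e2 : ∫ x in Ω, w' x * φ x = ∫ x in Ω, w x * φ x :=
    integral_congr_ae (by filter_upwards [hw] with x hx; rw [hx])
  rw [e1, e2]
  exact h.2.2 φ hφ hc hs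

lemma isWeakPartial_weakPartial (h : ∃ w, IsWeakPartial Ω i u w) :
    IsWeakPartial Ω i u (weakPartial Ω i u) := by
  rw [weakPartial, dif_pos h]
  exact h.choose_spec

lemma IsWeakPartial.weakPartial_ae_eq (hΩ : IsOpen Ω) (h : IsWeakPartial Ω i u w) :
    weakPartial Ω i u =ᵐ[volume.restrict Ω] w :=
  (isWeakPartial_weakPartial ⟨w, h⟩).ae_unique hΩ h

lemma IsWeakPartial.add (h : IsWeakPartial Ω i u w) (h' : IsWeakPartial Ω i v w') :
    IsWeakPartial Ω i (u + v) (w + w') := by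
  refine ⟨h.1.add h'.1, h.2.1.add h'.2.1, fun φ hφ hc hs => ?_⟩
  have hd := continuous_fderiv_apply_of_contDiff hφ (EuclideanSpace.single i 1)
  have hdc : HasCompactSupport fun x => fderiv ℝ φ x (EuclideanSpace.single i (1 : ℝ)) :=
    hc.fderiv_apply (𝕜 := ℝ) _
  have hds : tsupport (fun x => fderiv ℝ φ x (EuclideanSpace.single i (1 : ℝ))) ⊆ Ω :=
    (tsupport_fderiv_apply_subset ℝ _).trans hs
  simp only [Pi.add_apply, add_mul]
  rw [integral_add (integrableOn_mul_of_hasCompactSupport h.1 hd hdc hds)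
      (integrableOn_mul_of_hasCompactSupport h'.1 hd hdc hds),
    integral_add (integrableOn_mul_of_hasCompactSupport h.2.1 hφ.continuous hc hs)
      (integrableOn_mul_of_hasCompactSupport h'.2.1 hφ.continuous hc hs),
    h.2.2 φ hφ hc hs, h'.2.2 φ hφ hc hs]
  ring

lemma IsWeakPartial.const_smul (a : ℝ) (h : IsWeakPartial Ω i u w) :
    IsWeakPartial Ω i (a • u) (a • w) := by
  refine ⟨h.1.smul a, h.2.1.smul a, fun φ hφ hc hs => ?_⟩
  simp only [Pi.smul_apply, smul_eq_mul, mul_assoc, integral_const_mul]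
  rw [h.2.2 φ hφ hc hs]
  ring

lemma isWeakPartial_zero : IsWeakPartial Ω i (0 : E n → ℝ) 0 :=
  ⟨locallyIntegrableOn_zero, locallyIntegrableOn_zero, fun φ _ _ _ => by simp⟩

end WeakDerivatives

/-! ### The space `W^{2,p}`, its norm, and best approximation -/

section Sobolev

variable {n : ℕ} {Ω : Set (E n)} {p : ℝ≥0∞} {u v : E n → ℝ}

/-- A function belongs to `W^{2,p}(Ω)` as soon as it has weak derivatives in `Lᵖ(Ω)`. -/
lemma memW2_of_isWeakPartial (hΩ : IsOpen Ω) {u₁ : Fin n → E n → ℝ}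
    {u₂ : Fin n → Fin n → E n → ℝ} (h₁ : ∀ i, IsWeakPartial Ω i u (u₁ i))
    (h₂ : ∀ i j, IsWeakPartial Ω j (u₁ i) (u₂ i j)) (hu : MemLp u p (volume.restrict Ω))
    (hu₁ : ∀ i, MemLp (u₁ i) p (volume.restrict Ω))
    (hu₂ : ∀ i j, MemLp (u₂ i j) p (volume.restrict Ω)) :
    MemW2 Ω p u ∧ (∀ i, weakPartial Ω i u =ᵐ[volume.restrict Ω] u₁ i) ∧
      ∀ i j, weakPartial Ω j (weakPartial Ω i u) =ᵐ[volume.restrict Ω] u₂ i j := by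
  have e₁ i := (h₁ i).weakPartial_ae_eq hΩ
  have h₂' : ∀ i j, IsWeakPartial Ω j (weakPartial Ω i u) (u₂ i j) := fun i j =>
    (h₂ i j).congr (e₁ i).symm .rfl
  have e₂ i j := (h₂' i j).weakPartial_ae_eq hΩ
  exact ⟨⟨fun i => ⟨⟨_, h₁ i⟩, fun j => ⟨_, h₂' i j⟩⟩, hu,
    fun i => (memLp_congr_ae (e₁ i)).2 (hu₁ i),
    fun i j => (memLp_congr_ae (e₂ i j)).2 (hu₂ i j)⟩, e₁, e₂⟩

lemma MemW2.isWeakPartial (hu : MemW2 Ω p u) (i : Fin n) :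
    IsWeakPartial Ω i u (weakPartial Ω i u) :=
  isWeakPartial_weakPartial (hu.1 i).1

lemma MemW2.isWeakPartial₂ (hu : MemW2 Ω p u) (i j : Fin n) :
    IsWeakPartial Ω j (weakPartial Ω i u) (weakPartial Ω j (weakPartial Ω i u)) :=
  isWeakPartial_weakPartial ((hu.1 i).2 j)

lemma MemW2.add (hΩ : IsOpen Ω) (hu : MemW2 Ω p u) (hv : MemW2 Ω p v) :
    MemW2 Ω p (u + v) ∧
      (∀ i, weakPartial Ω i (u + v) =ᵐ[volume.restrict Ω] weakPartial Ω i u + weakPartial Ω i v) ∧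
      ∀ i j, weakPartial Ω j (weakPartial Ω i (u + v)) =ᵐ[volume.restrict Ω]
        weakPartial Ω j (weakPartial Ω i u) + weakPartial Ω j (weakPartial Ω i v) :=
  memW2_of_isWeakPartial hΩ (fun i => (hu.isWeakPartial i).add (hv.isWeakPartial i))
    (fun i j => (hu.isWeakPartial₂ i j).add (hv.isWeakPartial₂ i j)) (hu.2.1.add hv.2.1)
    (fun i => (hu.2.2.1 i).add (hv.2.2.1 i)) (fun i j => (hu.2.2.2 i j).add (hv.2.2.2 i j))

lemma MemW2.const_smul (hΩ : IsOpen Ω) (a : ℝ) (hu : MemW2 Ω p u) :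
    MemW2 Ω p (a • u) ∧
      (∀ i, weakPartial Ω i (a • u) =ᵐ[volume.restrict Ω] a • weakPartial Ω i u) ∧
      ∀ i j, weakPartial Ω j (weakPartial Ω i (a • u)) =ᵐ[volume.restrict Ω]
        a • weakPartial Ω j (weakPartial Ω i u) :=
  memW2_of_isWeakPartial hΩ (fun i => (hu.isWeakPartial i).const_smul a)
    (fun i j => (hu.isWeakPartial₂ i j).const_smul a) (hu.2.1.const_smul a)
    (fun i => (hu.2.2.1 i).const_smul a) (fun i j => (hu.2.2.2 i j).const_smul a)

lemma MemW2.mono_exponent {q : ℝ≥0∞} (hΩ : Bornology.IsBounded Ω) (hpq : p ≤ q)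
    (hu : MemW2 Ω q u) : MemW2 Ω p u := by
  have : IsFiniteMeasure (volume.restrict Ω) :=
    ⟨by simpa using hΩ.measure_lt_top⟩
  exact ⟨hu.1, hu.2.1.mono_exponent hpq, fun i => (hu.2.2.1 i).mono_exponent hpq,
    fun i j => (hu.2.2.2 i j).mono_exponent hpq⟩

/-- The Sobolev space `W^{2,p}(Ω)`. -/
def spaceW2 (hΩ : IsOpen Ω) (p : ℝ≥0∞) : Submodule ℝ (E n → ℝ) where
  carrier := {u | MemW2 Ω p u}
  add_mem' hu hv := (hu.add hΩ hv).1
  zero_mem' := (memW2_of_isWeakPartial hΩ (fun _ => isWeakPartial_zero)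
    (fun _ _ => isWeakPartial_zero) MemLp.zero (fun _ => MemLp.zero) (fun _ _ => MemLp.zero)).1
  smul_mem' a _ hu := (hu.const_smul hΩ a).1

/-- The weak Hessian as a vector, whose norm is the Frobenius norm. -/
noncomputable def weakHessVec (Ω : Set (E n)) (u : E n → ℝ) (x : E n) :
    EuclideanSpace ℝ (Fin n × Fin n) :=
  WithLp.toLp 2 fun q => weakHess Ω u x q.1 q.2

lemma norm_weakHessVec (x : E n) : ‖weakHessVec Ω u x‖ = frobenius (weakHess Ω u x) := by
  rw [EuclideanSpace.norm_eq, frobenius, Fintype.sum_prod_type]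
  simp [weakHessVec]

lemma MemW2.memLp_weakGrad (hu : MemW2 Ω p u) : MemLp (weakGrad Ω u) p (volume.restrict Ω) :=
  MemLp.of_eval_piLp fun i => hu.2.2.1 i

lemma MemW2.memLp_weakHessVec (hu : MemW2 Ω p u) :
    MemLp (weakHessVec Ω u) p (volume.restrict Ω) :=
  -- The indices are swapped because `weakHess` differentiates in its second index first, whereas
  -- `DerivsMemLp2` differentiates in its first index first.
  MemLp.of_eval_piLp fun q => hu.2.2.2 q.2 q.1

lemma MemW2.weakGrad_add (hΩ : IsOpen Ω) (hu : MemW2 Ω p u) (hv : MemW2 Ω p v) :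
    weakGrad Ω (u + v) =ᵐ[volume.restrict Ω] weakGrad Ω u + weakGrad Ω v := by
  filter_upwards [ae_all_iff.2 (hu.add hΩ hv).2.1] with x hx
  ext i
  simpa [weakGrad] using hx i

lemma MemW2.weakHessVec_add (hΩ : IsOpen Ω) (hu : MemW2 Ω p u) (hv : MemW2 Ω p v) :
    weakHessVec Ω (u + v) =ᵐ[volume.restrict Ω] weakHessVec Ω u + weakHessVec Ω v := by
  filter_upwards [ae_all_iff.2 fun i => ae_all_iff.2 ((hu.add hΩ hv).2.2 i)] with x hx
  ext q
  simpa [weakHessVec, weakHess] using hx q.2 q.1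

lemma MemW2.weakGrad_smul (hΩ : IsOpen Ω) (a : ℝ) (hu : MemW2 Ω p u) :
    weakGrad Ω (a • u) =ᵐ[volume.restrict Ω] a • weakGrad Ω u := by
  filter_upwards [ae_all_iff.2 (hu.const_smul hΩ a).2.1] with x hx
  ext i
  simpa [weakGrad] using hx i

lemma MemW2.weakHessVec_smul (hΩ : IsOpen Ω) (a : ℝ) (hu : MemW2 Ω p u) :
    weakHessVec Ω (a • u) =ᵐ[volume.restrict Ω] a • weakHessVec Ω u := by
  filter_upwards [ae_all_iff.2 fun i => ae_all_iff.2 ((hu.const_smul hΩ a).2.2 i)] with x hx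
  ext q
  simpa [weakHessVec, weakHess] using hx q.2 q.1

/-- The embedding of `W^{2,p}(Ω)` into a product of Lebesgue spaces. -/
noncomputable def jet (hΩ : IsOpen Ω) (p : ℝ≥0∞) :
    spaceW2 hΩ p →ₗ[ℝ] Lp ℝ p (volume.restrict Ω) × Lp (E n) p (volume.restrict Ω) ×
      Lp (EuclideanSpace ℝ (Fin n × Fin n)) p (volume.restrict Ω) where
  toFun u := (MemLp.toLp _ u.2.2.1, MemLp.toLp _ (MemW2.memLp_weakGrad u.2),
    MemLp.toLp _ (MemW2.memLp_weakHessVec u.2))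
  map_add' u v := by
    refine Prod.ext ?_ (Prod.ext ?_ ?_)
    · exact MemLp.toLp_add u.2.2.1 v.2.2.1
    · exact (MemLp.toLp_congr (MemW2.memLp_weakGrad (u + v).2) ((MemW2.memLp_weakGrad u.2).add (MemW2.memLp_weakGrad v.2))
        (MemW2.weakGrad_add hΩ u.2 v.2)).trans
        (MemLp.toLp_add (MemW2.memLp_weakGrad u.2) (MemW2.memLp_weakGrad v.2))
    · exact (MemLp.toLp_congr (MemW2.memLp_weakHessVec (u + v).2) ((MemW2.memLp_weakHessVec u.2).add (MemW2.memLp_weakHessVec v.2))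
        (MemW2.weakHessVec_add hΩ u.2 v.2)).trans
        (MemLp.toLp_add (MemW2.memLp_weakHessVec u.2) (MemW2.memLp_weakHessVec v.2))
  map_smul' a u := by
    refine Prod.ext ?_ (Prod.ext ?_ ?_)
    · exact MemLp.toLp_const_smul a u.2.2.1
    · exact (MemLp.toLp_congr (MemW2.memLp_weakGrad (a • u).2) ((MemW2.memLp_weakGrad u.2).const_smul a)
        (MemW2.weakGrad_smul hΩ a u.2)).trans
        (MemLp.toLp_const_smul a (MemW2.memLp_weakGrad u.2))
    · exact (MemLp.toLp_congr (MemW2.memLp_weakHessVec (a • u).2) ((MemW2.memLp_weakHessVec u.2).const_smul a)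
        (MemW2.weakHessVec_smul hΩ a u.2)).trans
        (MemLp.toLp_const_smul a (MemW2.memLp_weakHessVec u.2))

lemma lpNorm_eq_norm_toLp {F : Type*} [NormedAddCommGroup F] {f : E n → F} {μ : Measure (E n)}
    (hf : MemLp f p μ) : lpNorm f p μ = ‖hf.toLp f‖ := by
  rw [Lp.norm_toLp, toReal_eLpNorm hf.1]

lemma lpNorm_congr_ae {F : Type*} [NormedAddCommGroup F] {f g : E n → F} {μ : Measure (E n)}
    (h : f =ᵐ[μ] g) : lpNorm f p μ = lpNorm g p μ := by
  unfold lpNorm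
  rw [aestronglyMeasurable_congr h, eLpNorm_congr_ae h]

lemma MemW2.lpNorm_frobenius (hu : MemW2 Ω p u) :
    lpNorm (fun x => frobenius (weakHess Ω u x)) p (volume.restrict Ω)
      = lpNorm (weakHessVec Ω u) p (volume.restrict Ω) := by
  simp only [← norm_weakHessVec]
  exact lpNorm_norm hu.memLp_weakHessVec.1 p

lemma normW2_pow {m : ℕ} (hm : 1 ≤ m) (hu : MemW2 Ω m u) :
    normW2 Ω m u ^ m = lpNorm u m (volume.restrict Ω) ^ m
      + lpNorm (weakGrad Ω u) m (volume.restrict Ω) ^ m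
      + lpNorm (weakHessVec Ω u) m (volume.restrict Ω) ^ m := by
  rw [normW2, hu.lpNorm_frobenius, one_div, Real.rpow_inv_natCast_pow _ (by omega)]
  have h {F : Type} [NormedAddCommGroup F] (f : E n → F) : 0 ≤ lpNorm f m (volume.restrict Ω) :=
    lpNorm_nonneg
  have := h u
  have := h (weakGrad Ω u)
  have := h (weakHessVec Ω u)
  positivity

lemma normW2_nonneg {m : ℕ} : 0 ≤ normW2 Ω m u := by
  have h {F : Type} [NormedAddCommGroup F] (f : E n → F) : 0 ≤ lpNorm f m (volume.restrict Ω) :=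
    lpNorm_nonneg
  have := h u
  have := h (weakGrad Ω u)
  have := h (fun x => frobenius (weakHess Ω u x))
  unfold normW2
  positivity

/-- The three contributions are bounded by the Sobolev norm. -/
lemma lpNorm_le_normW2 {m : ℕ} (hm : 1 ≤ m) (hu : MemW2 Ω m u) :
    lpNorm u m (volume.restrict Ω) ≤ normW2 Ω m u ∧
      lpNorm (weakGrad Ω u) m (volume.restrict Ω) ≤ normW2 Ω m u ∧
      lpNorm (weakHessVec Ω u) m (volume.restrict Ω) ≤ normW2 Ω m u := by
  have h {F : Type} [NormedAddCommGroup F] (f : E n → F) :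
      0 ≤ lpNorm f m (volume.restrict Ω) ^ m := pow_nonneg lpNorm_nonneg _
  have h1 := h u
  have h2 := h (weakGrad Ω u)
  have h3 := h (weakHessVec Ω u)
  have e := normW2_pow hm hu
  refine ⟨?_, ?_, ?_⟩ <;> refine le_of_pow_le_pow_left₀ (n := m) (by omega) normW2_nonneg ?_ <;>
    linarith

/-- Best approximations in finite-dimensional subspaces of a product of three normed spaces. -/
lemma exists_best_approximation {m : ℕ} (hm : m ≠ 0) {X₁ X₂ X₃ : Type*} [NormedAddCommGroup X₁]
    [NormedSpace ℝ X₁] [NormedAddCommGroup X₂] [NormedSpace ℝ X₂] [NormedAddCommGroup X₃]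
    [NormedSpace ℝ X₃] (Y : Submodule ℝ (X₁ × X₂ × X₃)) [FiniteDimensional ℝ Y]
    (a : X₁ × X₂ × X₃) :
    ∃ y ∈ Y, ∀ z ∈ Y, ‖(a - y).1‖ ^ m + ‖(a - y).2.1‖ ^ m + ‖(a - y).2.2‖ ^ m
      ≤ ‖(a - z).1‖ ^ m + ‖(a - z).2.1‖ ^ m + ‖(a - z).2.2‖ ^ m := by
  let G : Y → ℝ := fun y =>
    ‖(a - y.1).1‖ ^ m + ‖(a - y.1).2.1‖ ^ m + ‖(a - y.1).2.2‖ ^ m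
  have hG : Continuous G := by fun_prop
  -- Coercivity: `x ≤ x ^ m + 1` for `x ≥ 0` bounds the norm of `a - y` by `G y + 1`. A continuous
  -- coercive function on a finite-dimensional space attains its minimum.
  have hlow : ∀ y : Y, ‖y.1‖ - ‖a‖ ≤ G y + 1 := by
    intro y
    have h1 : ‖y.1‖ - ‖a‖ ≤ ‖a - y.1‖ := by
      rw [norm_sub_rev]; exact norm_sub_norm_le _ _
    have h2 : ∀ x : ℝ, 0 ≤ x → x ≤ x ^ m + 1 := by
      intro x hx
      rcases le_total x 1 with h | h
      · linarith [pow_nonneg hx m]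
      · linarith [le_self_pow₀ h hm]
    have e1 := pow_nonneg (norm_nonneg (a - y.1).1) m
    have e2 := pow_nonneg (norm_nonneg (a - y.1).2.1) m
    have e3 := pow_nonneg (norm_nonneg (a - y.1).2.2) m
    refine h1.trans ?_
    rw [Prod.norm_def, Prod.norm_def]
    refine max_le ?_ (max_le ?_ ?_) <;> refine (h2 _ (norm_nonneg _)).trans ?_ <;>
      · simp only [G]; linarith
  have hcoer : Tendsto G (cocompact Y) atTop := by
    refine tendsto_atTop_mono (f := fun y : Y => ‖y‖ + (-‖a‖ - 1)) (fun y => ?_) ?_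
    · have := hlow y
      rw [Submodule.coe_norm]
      linarith
    · exact tendsto_atTop_add_const_right _ _ (tendsto_norm_cocompact_atTop (E := Y))
  obtain ⟨y, hy⟩ := hG.exists_forall_le hcoer
  exact ⟨y, y.2, fun z hz => hy ⟨z, hz⟩⟩

lemma normW2_pow_eq_norm_jet {m : ℕ} (hm : 1 ≤ m) (hΩ : IsOpen Ω) (u : spaceW2 hΩ m) :
    normW2 Ω m u ^ m
      = ‖(jet hΩ m u).1‖ ^ m + ‖(jet hΩ m u).2.1‖ ^ m + ‖(jet hΩ m u).2.2‖ ^ m := by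
  rw [normW2_pow hm u.2, lpNorm_eq_norm_toLp u.2.2.1, lpNorm_eq_norm_toLp (MemW2.memLp_weakGrad u.2),
    lpNorm_eq_norm_toLp (MemW2.memLp_weakHessVec u.2)]
  rfl

/-- Best approximations from finite-dimensional subspaces of `W^{2,m}(Ω)` exist. -/
lemma exists_isLeast_normW2 {m : ℕ} (hm : 1 ≤ m) (hΩ : IsOpen Ω) (V : Submodule ℝ (E n → ℝ))
    [FiniteDimensional ℝ V] (hV : ∀ v ∈ V, MemW2 Ω m v) (hu : MemW2 Ω m u) :
    ∃ v ∈ V, IsLeast {r | ∃ v ∈ V, r = normW2 Ω m (u - v) ^ m} (normW2 Ω m (u - v) ^ m) := by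
  have : Fact ((1 : ℝ≥0∞) ≤ m) := ⟨by exact_mod_cast hm⟩
  have hVle : V ≤ spaceW2 hΩ m := hV
  -- The minimization takes place on the image in the Lebesgue spaces: on functions the norm is only
  -- a seminorm, blind to null sets and to values outside `Ω`.
  let J := (jet hΩ m).comp (Submodule.inclusion hVle)
  obtain ⟨_, ⟨v, rfl⟩, hy⟩ :=
    exists_best_approximation (m := m) (by omega) (LinearMap.range J) (jet hΩ m ⟨u, hu⟩)
  have key (v : V) : jet hΩ m ⟨u, hu⟩ - J v
      = jet hΩ m ⟨u - v, (spaceW2 hΩ m).sub_mem hu (hV _ v.2)⟩ :=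
    ((jet hΩ m).map_sub ⟨u, hu⟩ ⟨v, hV _ v.2⟩).symm
  refine ⟨v, v.2, ⟨v, v.2, rfl⟩, ?_⟩
  rintro _ ⟨v', hv', rfl⟩
  have h := hy (J ⟨v', hv'⟩) ⟨_, rfl⟩
  rw [key, key, ← normW2_pow_eq_norm_jet hm, ← normW2_pow_eq_norm_jet hm] at h
  exact h

end Sobolev

/-! ### Linearity and boundedness of the differential operator -/

section Operator

variable {n : ℕ} {Ω : Set (E n)} {p : ℝ≥0∞} {u v : E n → ℝ}
  {A : E n → Matrix (Fin n) (Fin n) ℝ} {b : E n → E n} {c : E n → ℝ}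

lemma opL_sub_ae_eq (hΩ : IsOpen Ω) (hu : MemW2 Ω p u) (hv : MemW2 Ω p v) :
    opL Ω A b c (u - v) =ᵐ[volume.restrict Ω] fun x => opL Ω A b c u x - opL Ω A b c v x := by
  have hv' := (hv.const_smul hΩ (-1)).1
  have e : u - v = u + (-1 : ℝ) • v := by rw [neg_one_smul, sub_eq_add_neg]
  rw [e]
  filter_upwards [hu.weakGrad_add hΩ hv', hv.weakGrad_smul hΩ (-1), hu.weakHessVec_add hΩ hv',
    hv.weakHessVec_smul hΩ (-1)] with x h1 h2 h3 h4
  have hG : weakGrad Ω (u + (-1 : ℝ) • v) x = weakGrad Ω u x - weakGrad Ω v x := by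
    rw [h1, Pi.add_apply, h2, Pi.smul_apply, neg_one_smul, sub_eq_add_neg]
  have hH i j : weakHess Ω (u + (-1 : ℝ) • v) x i j = weakHess Ω u x i j - weakHess Ω v x i j := by
    have h : weakHessVec Ω (u + (-1 : ℝ) • v) x = weakHessVec Ω u x - weakHessVec Ω v x := by
      rw [h3, Pi.add_apply, h4, Pi.smul_apply, neg_one_smul, sub_eq_add_neg]
    simpa [weakHessVec] using congrArg (fun y => y (i, j)) h
  simp only [opL, hG, hH, inner_sub_right, mul_sub, Finset.sum_sub_distrib, Pi.add_apply,
    Pi.smul_apply, smul_eq_mul]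
  ring

/-- No measurability of `f` is required, as `lpNorm` is `0` on functions that are not measurable.
This spares a measurability proof for `opL`. -/
lemma lpNorm_le_of_ae_le {F : Type*} [NormedAddCommGroup F] {μ : Measure (E n)} {f : E n → F}
    {g : E n → ℝ} (hg : MemLp g p μ) (h : ∀ᵐ x ∂μ, ‖f x‖ ≤ g x) :
    lpNorm f p μ ≤ lpNorm g p μ := by
  by_cases hf : AEStronglyMeasurable f μ
  · rw [← toReal_eLpNorm hf, ← toReal_eLpNorm hg.1]
    exact ENNReal.toReal_mono hg.2.ne (eLpNorm_mono_ae_real h)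
  · rw [lpNorm_of_not_aestronglyMeasurable hf]
    exact lpNorm_nonneg

/-- The operator is bounded from `W^{2,m}(Ω)` to `Lᵐ(Ω)`. -/
lemma exists_lpNorm_opL_le {m : ℕ} (hm : 1 ≤ m) (hΩ : IsOpen Ω) (hb : Bornology.IsBounded Ω)
    (hA : ContinuousOn A (closure Ω)) (hdrift : MemLp b ∞ (volume.restrict Ω))
    (hreact : MemLp c ∞ (volume.restrict Ω)) :
    ∃ C : ℝ, 0 ≤ C ∧ ∀ w, MemW2 Ω m w →
      lpNorm (opL Ω A b c w) m (volume.restrict Ω) ≤ C * normW2 Ω m w := by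
  have hcomp : IsCompact (closure Ω) := hb.isCompact_closure
  have hM : ∀ i j, ∃ M, ∀ x ∈ closure Ω, ‖A x i j‖ ≤ M := fun i j =>
    hcomp.exists_bound_of_continuousOn
      ((continuous_apply_apply i j).comp_continuousOn hA : ContinuousOn (fun x => A x i j) _)
  choose M hM using hM
  -- The absolute values keep `MA` nonnegative even if `Ω` is empty and the bounds `M i j` are
  -- arbitrary.
  set MA : ℝ := ∑ i, ∑ j, |M i j| with hMA
  set Mb : ℝ := lpNorm b ∞ (volume.restrict Ω)
  set Mc : ℝ := lpNorm c ∞ (volume.restrict Ω)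
  have hMA0 : 0 ≤ MA := Finset.sum_nonneg fun i _ => Finset.sum_nonneg fun j _ => abs_nonneg _
  have hMb0 : 0 ≤ Mb := lpNorm_nonneg
  have hMc0 : 0 ≤ Mc := lpNorm_nonneg
  refine ⟨MA + Mb + Mc, by positivity, fun w hw => ?_⟩
  have hpt : ∀ᵐ x ∂volume.restrict Ω, ‖opL Ω A b c w x‖ ≤
      (MA • (fun x => ‖weakHessVec Ω w x‖) + Mb • (fun x => ‖weakGrad Ω w x‖)
        + Mc • fun x => ‖w x‖) x := by
    filter_upwards [ae_le_lpNorm_exponent_top hdrift, ae_le_lpNorm_exponent_top hreact,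
      ae_restrict_mem hΩ.measurableSet] with x h1 h2 hx
    have hH i j : ‖weakHess Ω w x i j‖ ≤ ‖weakHessVec Ω w x‖ :=
      PiLp.norm_apply_le (weakHessVec Ω w x) (i, j)
    have e1 : ‖∑ i, ∑ j, A x i j * weakHess Ω w x i j‖ ≤ MA * ‖weakHessVec Ω w x‖ := by
      rw [hMA, Finset.sum_mul]
      refine (norm_sum_le _ _).trans (Finset.sum_le_sum fun i _ => ?_)
      rw [Finset.sum_mul]
      refine (norm_sum_le _ _).trans (Finset.sum_le_sum fun j _ => ?_)
      rw [norm_mul]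
      exact mul_le_mul ((hM i j x (subset_closure hx)).trans (le_abs_self _)) (hH i j)
        (norm_nonneg _) (abs_nonneg _)
    have e2 : ‖⟪b x, weakGrad Ω w x⟫_ℝ‖ ≤ Mb * ‖weakGrad Ω w x‖ :=
      (norm_inner_le_norm _ _).trans (mul_le_mul_of_nonneg_right h1 (norm_nonneg _))
    have e3 : ‖c x * w x‖ ≤ Mc * ‖w x‖ := by
      rw [norm_mul]
      exact mul_le_mul_of_nonneg_right h2 (norm_nonneg _)
    simp only [Pi.add_apply, Pi.smul_apply, smul_eq_mul, opL]
    refine (norm_add₃_le).trans ?_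
    rw [norm_neg]
    gcongr
  obtain ⟨n1, n2, n3⟩ := lpNorm_le_normW2 hm hw
  have m1 := hw.2.1
  have m2 := hw.memLp_weakGrad
  have m3 := hw.memLp_weakHessVec
  have h1m : (1 : ℝ≥0∞) ≤ m := by exact_mod_cast hm
  have k1 := (m3.norm.const_smul MA)
  have k2 := (m2.norm.const_smul Mb)
  have k3 := (m1.norm.const_smul Mc)
  have hsm (a : ℝ) (ha : 0 ≤ a) (f : E n → ℝ) :
      lpNorm (a • f) m (volume.restrict Ω) = a * lpNorm f m (volume.restrict Ω) := by
    rw [lpNorm_const_smul, coe_nnnorm, Real.norm_of_nonneg ha]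
  calc lpNorm (opL Ω A b c w) m (volume.restrict Ω)
      ≤ lpNorm (MA • (fun x => ‖weakHessVec Ω w x‖) + Mb • (fun x => ‖weakGrad Ω w x‖)
        + Mc • fun x => ‖w x‖) m (volume.restrict Ω) := lpNorm_le_of_ae_le ((k1.add k2).add k3) hpt
    _ ≤ MA * lpNorm (weakHessVec Ω w) m (volume.restrict Ω)
        + Mb * lpNorm (weakGrad Ω w) m (volume.restrict Ω)
        + Mc * lpNorm w m (volume.restrict Ω) := by
      refine (lpNorm_add_le (k1.add k2) h1m).trans ?_
      refine (add_le_add_left (lpNorm_add_le k1 h1m) _).trans ?_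
      rw [hsm _ hMA0, hsm _ hMb0, hsm _ hMc0, lpNorm_norm m3.1, lpNorm_norm m2.1, lpNorm_norm m1.1]
    _ ≤ MA * normW2 Ω m w + Mb * normW2 Ω m w + Mc * normW2 Ω m w := by gcongr
    _ = _ := by ring

end Operator

/-! ### Mollification, scaling, and the formula along rays -/

section Mollification

variable {n : ℕ} {Ω : Set (E n)} {i : Fin n} {p : ℝ≥0∞} {u w : E n → ℝ}

/-- The mollification of the extension by zero of `u` from `Ω`. -/
noncomputable def mollify (φ : ContDiffBump (0 : E n)) (Ω : Set (E n)) (u : E n → ℝ) : E n → ℝ :=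
  convolution (φ.normed volume) (Ω.indicator u) (ContinuousLinearMap.lsmul ℝ ℝ) volume

lemma mollify_apply (φ : ContDiffBump (0 : E n)) (x : E n) :
    mollify φ Ω u x = ∫ y, φ.normed volume (x - y) * Ω.indicator u y := by
  rw [mollify, convolution_eq_swap]
  simp

lemma locallyIntegrable_indicator (hΩ : MeasurableSet Ω) (hu : IntegrableOn u Ω) :
    LocallyIntegrable (Ω.indicator u) :=
  ((integrable_indicator_iff hΩ).2 hu).locallyIntegrable

lemma continuous_mollify (φ : ContDiffBump (0 : E n)) (hΩ : MeasurableSet Ω)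
    (hu : IntegrableOn u Ω) : Continuous (mollify φ Ω u) :=
  φ.hasCompactSupport_normed.continuous_convolution_left _ φ.continuous_normed
    (locallyIntegrable_indicator hΩ hu)

/-- At points of positive distance to the complement of `Ω`, mollification commutes with weak
differentiation. -/
lemma IsWeakPartial.fderiv_mollify {φ : ContDiffBump (0 : E n)} (hΩ : MeasurableSet Ω)
    (h : IsWeakPartial Ω i u w) {x : E n} (hu : IntegrableOn u Ω)
    (hx : Metric.closedBall x φ.rOut ⊆ Ω) :
    fderiv ℝ (mollify φ Ω u) x (EuclideanSpace.single i 1) = mollify φ Ω w x := by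
  set ρ : E n → ℝ := φ.normed volume with hρ
  have hρs : ContDiff ℝ ∞ ρ := φ.contDiff_normed
  have hρ1 : ContDiff ℝ 1 ρ := φ.contDiff_normed (n := 1)
  have hD := (φ.hasCompactSupport_normed (μ := volume)).hasFDerivAt_convolution_left
    (ContinuousLinearMap.lsmul ℝ ℝ) hρ1 (locallyIntegrable_indicator hΩ hu) x
  have hex : ConvolutionExistsAt (fderiv ℝ ρ) (Ω.indicator u) x
      ((ContinuousLinearMap.lsmul ℝ ℝ).precompL (E n)) volume :=
    (φ.hasCompactSupport_normed.fderiv ℝ).convolutionExists_left _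
      (hρ1.continuous_fderiv (by simp)) (locallyIntegrable_indicator hΩ hu) x
  have hswap : convolution (fderiv ℝ ρ) (Ω.indicator u)
      ((ContinuousLinearMap.lsmul ℝ ℝ).precompL (E n)) volume x (EuclideanSpace.single i 1)
      = ∫ y, fderiv ℝ ρ (x - y) (EuclideanSpace.single i 1) * Ω.indicator u y := by
    rw [convolution_eq_swap, ContinuousLinearMap.integral_apply]
    · simp
    · exact hex.integrable_swap
  -- The reflected kernel is an admissible test function because its support lies in the closed ball
  -- around `x`. The sign from the reflection cancels the sign from integration by parts.
  let ψ : E n → ℝ := fun y => ρ (x - y)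
  have hψ : ContDiff ℝ ∞ ψ := hρs.comp (contDiff_const.sub contDiff_id)
  have hψt : tsupport ψ ⊆ Metric.closedBall x φ.rOut := by
    refine closure_minimal (fun y hy => ?_) Metric.isClosed_closedBall
    have : x - y ∈ Function.support ρ := hy
    rw [hρ, φ.support_normed_eq, mem_ball_zero_iff] at this
    rw [Metric.mem_closedBall, dist_comm, dist_eq_norm]
    exact this.le
  have hψc : HasCompactSupport ψ :=
    (isCompact_closedBall x φ.rOut).of_isClosed_subset (isClosed_tsupport ψ) hψt
  have hψd : ∀ y, fderiv ℝ ψ y (EuclideanSpace.single i 1)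
      = -fderiv ℝ ρ (x - y) (EuclideanSpace.single i 1) := by
    intro y
    have h1 : HasFDerivAt ρ (fderiv ℝ ρ (x - y)) (x - y) :=
      (hρ1.differentiable (by simp) _).hasFDerivAt
    have h2 := h1.comp y ((hasFDerivAt_id y).const_sub x)
    rw [show ψ = ρ ∘ HSub.hSub x from rfl, h2.fderiv]
    simp
  have key := h.2.2 ψ hψ hψc (hψt.trans hx)
  rw [show mollify φ Ω u = convolution ρ (Ω.indicator u) _ volume from rfl, hD.fderiv, hswap,
    mollify_apply]
  have e1 : ∫ y, fderiv ℝ ρ (x - y) (EuclideanSpace.single i 1) * Ω.indicator u y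
      = -∫ y in Ω, u y * fderiv ℝ ψ y (EuclideanSpace.single i 1) := by
    rw [← integral_indicator hΩ, ← integral_neg]
    congr 1 with y
    by_cases hy : y ∈ Ω <;> simp [hy, hψd, mul_comm]
  have e2 : ∫ y, ρ (x - y) * Ω.indicator w y = ∫ y in Ω, w y * ψ y := by
    rw [← integral_indicator hΩ]
    congr 1 with y
    by_cases hy : y ∈ Ω <;> simp [hy, ψ, mul_comm]
  rw [e1, e2, key, neg_neg]

lemma differentiable_mollify (φ : ContDiffBump (0 : E n)) (hΩ : MeasurableSet Ω)
    (hu : IntegrableOn u Ω) : Differentiable ℝ (mollify φ Ω u) := fun x =>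
  ((φ.hasCompactSupport_normed (μ := volume)).hasFDerivAt_convolution_left
    (ContinuousLinearMap.lsmul ℝ ℝ) (φ.contDiff_normed (n := 1))
    (locallyIntegrable_indicator hΩ hu) x).differentiableAt

/-- The derivative of a mollified function along a ray. -/
lemma hasDerivAt_mollify_ray {φ : ContDiffBump (0 : E n)} (hΩ : MeasurableSet Ω)
    {w : Fin n → E n → ℝ} (h : ∀ i, IsWeakPartial Ω i u (w i)) {x y : E n} {s : ℝ}
    (hu : IntegrableOn u Ω) (hx : Metric.closedBall (x + s • y) φ.rOut ⊆ Ω) :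
    HasDerivAt (fun s : ℝ => mollify φ Ω u (x + s • y))
      (∑ i, y i * mollify φ Ω (w i) (x + s • y)) s := by
  have h1 := (differentiable_mollify φ hΩ hu (x + s • y)).hasFDerivAt
  have h2 : HasDerivAt (fun s : ℝ => x + s • y) y s := by
    simpa using ((hasDerivAt_id s).smul_const y).const_add x
  have h3 := h1.comp_hasDerivAt s h2
  refine h3.congr_deriv ?_
  have hy : y = ∑ i, y i • EuclideanSpace.single i (1 : ℝ) := by
    simpa using ((EuclideanSpace.basisFun (Fin n) ℝ).sum_repr y).symm
  refine (congrArg (fderiv ℝ (mollify φ Ω u) (x + s • y)) hy).trans ?_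
  rw [map_sum]
  refine Finset.sum_congr rfl fun i _ => ?_
  rw [map_smul, (h i).fderiv_mollify hΩ hu hx, smul_eq_mul]

/-- Mean values of mollifications over dilated sets, the scaling being compensated by the
dilation factor in the borderline case that the exponent is the dimension. -/
lemma lintegral_mollify_dilation_le (hn : 1 ≤ n) (φ : ContDiffBump (0 : E n))
    (hΩ : MeasurableSet Ω) (hu : MemLp u n (volume.restrict Ω)) (x : E n) {s : ℝ} (hs : 0 < s)
    (B : Set (E n)) :
    ∫⁻ y in B, ‖mollify φ Ω u (x + s • y)‖ₑ ≤
      ENNReal.ofReal s⁻¹ * eLpNorm u n (volume.restrict Ω)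
        * volume B ^ (1 - 1 / (n : ℝ)) := by
  -- A strongly measurable representative of the extension by zero, needed for Tonelli and for
  -- affine substitutions; convolutions do not see the difference.
  set U : E n → ℝ := (((memLp_indicator_iff_restrict hΩ).2 hu).1).mk (Ω.indicator u) with hU
  have hUm : StronglyMeasurable U := AEStronglyMeasurable.stronglyMeasurable_mk _
  have hUe : Ω.indicator u =ᵐ[volume] U := AEStronglyMeasurable.ae_eq_mk _
  have hUn : eLpNorm U n volume = eLpNorm u n (volume.restrict Ω) := by
    rw [← eLpNorm_congr_ae hUe, eLpNorm_indicator_eq_eLpNorm_restrict hΩ]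
  set ρ : E n → ℝ := φ.normed volume with hρ
  have hρm : Measurable ρ := φ.continuous_normed.measurable
  have hmoll (z : E n) : ‖mollify φ Ω u z‖ₑ ≤ ∫⁻ t, ‖ρ t‖ₑ * ‖U (z - t)‖ₑ := by
    rw [mollify, convolution_congr _ Filter.EventuallyEq.rfl hUe]
    refine (enorm_integral_le_lintegral_enorm _).trans (le_of_eq ?_)
    simp [enorm_mul, hρ]
  have hinner (t : E n) : ∫⁻ y in B, ‖U (x + s • y - t)‖ₑ ≤
      ENNReal.ofReal s⁻¹ * eLpNorm u n (volume.restrict Ω)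
        * volume B ^ (1 - 1 / (n : ℝ)) := by
    have hm : Measurable fun y : E n => x + s • y - t := by fun_prop
    have hmeas : StronglyMeasurable fun y => U (x + s • y - t) := hUm.comp_measurable hm
    -- Hölder on `B` yields the power of its volume.
    have h1 := eLpNorm_le_eLpNorm_mul_rpow_measure_univ (μ := volume.restrict B)
      (p := 1) (q := n) (f := fun y => U (x + s • y - t)) (by exact_mod_cast hn)
      hmeas.aestronglyMeasurable
    rw [eLpNorm_one_eq_lintegral_enorm] at h1
    refine h1.trans ?_
    simp only [Measure.restrict_apply_univ, ENNReal.toReal_one, ENNReal.toReal_natCast, one_div_one]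
    gcongr
    refine (eLpNorm_mono_measure _ Measure.restrict_le_self).trans (le_of_eq ?_)
    -- The Jacobian factor is `s⁻ⁿ`; its `n`-th root, from the `Lⁿ` norm, is the factor `s⁻¹`. The
    -- translation by `t` plays no role, so averaging against the unit mass of `ρ` preserves the
    -- bound.
    have hmap : Measure.map (fun y : E n => x + s • y - t) volume
        = ENNReal.ofReal |(s ^ n)⁻¹| • volume := by
      have : (fun y : E n => x + s • y - t) = (fun z => (x - t) + z) ∘ fun y => s • y := by
        ext1 y; simp only [Function.comp_apply]; abel
      rw [this, ← Measure.map_map (by fun_prop) (by fun_prop),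
        Measure.map_addHaar_smul volume hs.ne', Measure.map_smul, map_add_left_eq_self]
      simp
    have h2 := eLpNorm_map_measure (p := n) (μ := volume) (f := fun y : E n => x + s • y - t)
      (g := U) hUm.aestronglyMeasurable hm.aemeasurable
    rw [hmap, eLpNorm_smul_measure_of_ne_top (by simp), hUn] at h2
    rw [show (fun y => U (x + s • y - t)) = U ∘ fun y : E n => x + s • y - t from rfl, ← h2,
      smul_eq_mul]
    congr 1
    rw [abs_of_pos (by positivity), ← inv_pow, ENNReal.ofReal_pow (by positivity)]
    simp only [one_div, ENNReal.toReal_inv, ENNReal.toReal_natCast]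
    rw [ENNReal.pow_rpow_inv_natCast (by omega)]
  calc ∫⁻ y in B, ‖mollify φ Ω u (x + s • y)‖ₑ
      ≤ ∫⁻ y in B, ∫⁻ t, ‖ρ t‖ₑ * ‖U (x + s • y - t)‖ₑ := lintegral_mono fun y => hmoll _
    _ = ∫⁻ t, ∫⁻ y in B, ‖ρ t‖ₑ * ‖U (x + s • y - t)‖ₑ := by
      refine lintegral_lintegral_swap (Measurable.aemeasurable ?_)
      have h1 : Measurable fun q : E n × E n => U (x + s • q.1 - q.2) :=
        hUm.measurable.comp (by fun_prop)
      exact ((hρm.comp measurable_snd).enorm).mul h1.enorm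
    _ = ∫⁻ t, ‖ρ t‖ₑ * ∫⁻ y in B, ‖U (x + s • y - t)‖ₑ := by
      refine lintegral_congr fun t => lintegral_const_mul' _ _ enorm_ne_top
    _ ≤ ∫⁻ t, ‖ρ t‖ₑ * (ENNReal.ofReal s⁻¹ * eLpNorm u n (volume.restrict Ω)
        * volume B ^ (1 - 1 / (n : ℝ))) := lintegral_mono fun t => by gcongr; exact hinner t
    _ = _ := by
      rw [lintegral_mul_const _ hρm.enorm]
      have : ∫⁻ t, ‖ρ t‖ₑ = 1 := by
        have h1 := ofReal_integral_norm_eq_lintegral_enorm (φ.integrable_normed (μ := volume))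
        rw [← hρ] at h1
        rw [← h1]
        have : ∀ t, ‖ρ t‖ = ρ t := fun t => Real.norm_of_nonneg (φ.nonneg_normed t)
        simp only [this]
        rw [hρ, φ.integral_normed, ENNReal.ofReal_one]
      rw [this, one_mul]

/-- A Sobolev representation formula in dimension one. -/
lemma abs_le_integral_of_hasDerivAt {h h' h'' : ℝ → ℝ}
    (h1 : ∀ s ∈ Icc (0 : ℝ) 1, HasDerivAt h (h' s) s)
    (h2 : ∀ s ∈ Icc (0 : ℝ) 1, HasDerivAt h' (h'' s) s) (h3 : Continuous h'')
    (c0 : Continuous h) (c1 : Continuous h') :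
    |h 0| ≤ ∫ s in (0 : ℝ)..1, s * (2 * |h s| + 4 * |h' s| + |h'' s|) := by
  -- With `g s = (1 - s) ^ 2 * h s` this is the function `s * g' - g`, whose derivative is `s *
  -- g''`. It vanishes at `1`, where `g` and `g'` do, and equals `-h 0` at `0`.
  have hd : ∀ s ∈ uIcc (0 : ℝ) 1, HasDerivAt
      (fun s => s * ((1 - s) ^ 2 * h' s - 2 * (1 - s) * h s) - (1 - s) ^ 2 * h s)
      (s * (2 * h s - 4 * (1 - s) * h' s + (1 - s) ^ 2 * h'' s)) s := by
    intro s hs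
    rw [uIcc_of_le zero_le_one] at hs
    have a0 : HasDerivAt (fun s : ℝ => 1 - s) (-1) s := by
      simpa using (hasDerivAt_id s).const_sub 1
    have a1 := (a0.pow 2)
    have := ((hasDerivAt_id s).mul ((a1.mul (h2 s hs)).sub ((a0.const_mul 2).mul (h1 s hs)))).sub
      (a1.mul (h1 s hs))
    refine this.congr_deriv ?_
    simp
    ring
  have hc : Continuous fun s => s * (2 * h s - 4 * (1 - s) * h' s + (1 - s) ^ 2 * h'' s) := by
    fun_prop
  have hint := intervalIntegral.integral_eq_sub_of_hasDerivAt hd (hc.intervalIntegrable _ _)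
  have e : h 0 = ∫ s in (0 : ℝ)..1, s * (2 * h s - 4 * (1 - s) * h' s + (1 - s) ^ 2 * h'' s) := by
    rw [hint]; ring
  rw [e]
  refine (intervalIntegral.abs_integral_le_integral_abs zero_le_one).trans ?_
  refine intervalIntegral.integral_mono_on zero_le_one (hc.abs.intervalIntegrable _ _)
    (Continuous.intervalIntegrable (by fun_prop) _ _) fun s hs => ?_
  rw [abs_mul, abs_of_nonneg hs.1]
  refine mul_le_mul_of_nonneg_left ?_ hs.1
  refine (abs_add_le _ _).trans (add_le_add ((abs_sub _ _).trans (add_le_add ?_ ?_)) ?_)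
  · rw [abs_mul, abs_two]
  · rw [abs_mul, abs_mul, abs_of_nonneg (by linarith [hs.2] : 0 ≤ 1 - s)]
    have : |(4 : ℝ)| = 4 := abs_of_pos (by norm_num)
    rw [this]
    nlinarith [mul_nonneg hs.1 (abs_nonneg (h' s))]
  · rw [abs_mul, abs_of_nonneg (sq_nonneg _)]
    have : (1 - s) ^ 2 ≤ 1 := by nlinarith [hs.1, hs.2]
    nlinarith [abs_nonneg (h'' s)]

end Mollification

/-! ### Interior cones and the pointwise Sobolev bound -/

section SupBound

variable {n : ℕ} {Ω : Set (E n)}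

/-- Averaging a pointwise bound by weighted integrals along rays over the directions in `B`. -/
lemma mul_volume_le_of_le_integral_rays (hn : 1 ≤ n) (hΩ : IsOpen Ω) (hb : Bornology.IsBounded Ω)
    {B : Set (E n)} (hBm : MeasurableSet B) (hBt : volume B ≠ ⊤) {ι : Type*} [Fintype ι]
    {F : ι → E n → ℝ} (hF : ∀ k, MemLp (F k) n (volume.restrict Ω)) {N : ℝ}
    (hN : ∀ k, lpNorm (F k) n (volume.restrict Ω) ≤ N) (hN0 : 0 ≤ N)
    (φ : ContDiffBump (0 : E n)) {a M : ℝ} (hM : 0 ≤ M) (x : E n)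
    (h : ∀ y ∈ B, a ≤
      ∫ s in (0 : ℝ)..1, s * (M * ∑ k, |mollify φ Ω (F k) (x + s • y)|)) :
    a * (volume B).toReal
      ≤ M * (Fintype.card ι * (N * (volume B ^ (1 - 1 / (n : ℝ))).toReal)) := by
  have hexp : 0 ≤ 1 - 1 / (n : ℝ) := by
    have : (1 : ℝ) ≤ n := by exact_mod_cast hn
    rw [sub_nonneg, div_le_one (by linarith)]
    exact this
  have hV : volume B ^ (1 - 1 / (n : ℝ)) ≠ ⊤ := ENNReal.rpow_ne_top_of_nonneg hexp hBt
  have : IsFiniteMeasure (volume.restrict Ω) := ⟨by simpa using hb.measure_lt_top⟩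
  have hint k : IntegrableOn (F k) Ω := (hF k).integrable (by exact_mod_cast hn)
  have hcont k : Continuous (mollify φ Ω (F k)) := continuous_mollify φ hΩ.measurableSet (hint k)
  have hC : Continuous fun q : E n × ℝ =>
      q.2 * (M * ∑ k, |mollify φ Ω (F k) (x + q.2 • q.1)|) := by fun_prop
  have hnn : ∀ s, 0 ≤ s → ∀ y, 0 ≤ s * (M * ∑ k, |mollify φ Ω (F k) (x + s • y)|) :=
    fun s hs y => mul_nonneg hs (mul_nonneg hM (Finset.sum_nonneg fun _ _ => abs_nonneg _))
  -- In `ℝ≥0∞`, Tonelli exchanges the integrals over `s` and `y` without integrability conditions.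
  have key : ENNReal.ofReal a * volume B ≤ ENNReal.ofReal M *
      (Fintype.card ι * (ENNReal.ofReal N * volume B ^ (1 - 1 / (n : ℝ)))) := by
    calc ENNReal.ofReal a * volume B = ∫⁻ _ in B, ENNReal.ofReal a := by
          rw [setLIntegral_const]
      _ ≤ ∫⁻ y in B, ∫⁻ s in Ioc (0 : ℝ) 1,
          ENNReal.ofReal (s * (M * ∑ k, |mollify φ Ω (F k) (x + s • y)|)) := by
        refine setLIntegral_mono' hBm fun y hy => ?_
        refine (ENNReal.ofReal_le_ofReal (h y hy)).trans (le_of_eq ?_)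
        rw [intervalIntegral.integral_of_le zero_le_one, ofReal_integral_eq_lintegral_ofReal]
        · have : Continuous fun s : ℝ => s * (M * ∑ k, |mollify φ Ω (F k) (x + s • y)|) :=
            hC.comp (Continuous.prodMk_right y)
          exact this.integrableOn_Ioc
        · filter_upwards [ae_restrict_mem measurableSet_Ioc] with s hs using hnn s hs.1.le y
      _ = ∫⁻ s in Ioc (0 : ℝ) 1, ∫⁻ y in B,
          ENNReal.ofReal (s * (M * ∑ k, |mollify φ Ω (F k) (x + s • y)|)) :=
        lintegral_lintegral_swap hC.measurable.ennreal_ofReal.aemeasurable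
      _ ≤ ∫⁻ _ in Ioc (0 : ℝ) 1, ENNReal.ofReal M *
          (Fintype.card ι * (ENNReal.ofReal N * volume B ^ (1 - 1 / (n : ℝ)))) := by
        refine setLIntegral_mono' measurableSet_Ioc fun s hs => ?_
        have e (y : E n) : ENNReal.ofReal (s * (M * ∑ k, |mollify φ Ω (F k) (x + s • y)|))
            = ENNReal.ofReal s * (ENNReal.ofReal M *
              ∑ k, ‖mollify φ Ω (F k) (x + s • y)‖ₑ) := by
          rw [ENNReal.ofReal_mul hs.1.le, ENNReal.ofReal_mul hM,
            ENNReal.ofReal_sum_of_nonneg fun _ _ => abs_nonneg _]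
          simp only [Real.enorm_eq_ofReal_abs]
        simp only [e]
        rw [lintegral_const_mul' _ _ ENNReal.ofReal_ne_top,
          lintegral_const_mul' _ _ ENNReal.ofReal_ne_top, lintegral_finsetSum _ fun k _ =>
            (Continuous.measurable (by fun_prop) : Measurable fun y =>
              mollify φ Ω (F k) (x + s • y)).enorm, mul_left_comm]
        refine mul_le_mul' le_rfl ?_
        calc ENNReal.ofReal s * ∑ k, ∫⁻ y in B, ‖mollify φ Ω (F k) (x + s • y)‖ₑ
            ≤ ENNReal.ofReal s * ∑ _k : ι, ENNReal.ofReal s⁻¹ *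
              (ENNReal.ofReal N * volume B ^ (1 - 1 / (n : ℝ))) := by
              gcongr with k
              refine (lintegral_mollify_dilation_le hn φ hΩ.measurableSet (hF k) x hs.1 B).trans ?_
              rw [mul_assoc, ← ofReal_lpNorm (hF k)]
              gcongr
              exact hN k
          -- The weight `s` from the ray formula cancels the scaling factor `s⁻¹`.
          _ = _ := by
              rw [Finset.sum_const, Finset.card_univ, nsmul_eq_mul, mul_left_comm,
                ← mul_assoc (ENNReal.ofReal s), ← ENNReal.ofReal_mul hs.1.le,
                mul_inv_cancel₀ hs.1.ne', ENNReal.ofReal_one, one_mul]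
      _ = _ := by simp
  have hfin : ENNReal.ofReal M *
      (Fintype.card ι * (ENNReal.ofReal N * volume B ^ (1 - 1 / (n : ℝ)))) ≠ ⊤ :=
    ENNReal.mul_ne_top ENNReal.ofReal_ne_top (ENNReal.mul_ne_top (by simp)
      (ENNReal.mul_ne_top ENNReal.ofReal_ne_top hV))
  have := ENNReal.toReal_mono hfin key
  simp only [ENNReal.toReal_mul, ENNReal.toReal_natCast, ENNReal.toReal_ofReal hM,
    ENNReal.toReal_ofReal hN0] at this
  refine le_trans ?_ this
  gcongr
  -- `a` may be negative, in which case `ENNReal.ofReal` truncates it to `0`.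
  exact ENNReal.toReal_ofReal' ▸ le_max_left _ _

lemma abs_sum_coord_mul_le {y : E n} {R : ℝ} (hy : ∀ i, |y i| ≤ R)
    (g : Fin n → ℝ) : |∑ i, y i * g i| ≤ R * ∑ i, |g i| := by
  rw [Finset.mul_sum]
  refine (Finset.abs_sum_le_sum_abs _ _).trans (Finset.sum_le_sum fun i _ => ?_)
  rw [abs_mul]
  exact mul_le_mul_of_nonneg_right (hy i) (abs_nonneg _)

/-- Each derivative along a ray costs one factor `R`; the weights `2, 4, 1` are those of
`abs_le_integral_of_hasDerivAt`. -/
lemma sobolev_weights_le {R a₀ a₁ a₂ b₁ b₂ : ℝ} (hR : 0 ≤ R) (p0 : 0 ≤ a₀) (p1 : 0 ≤ a₁)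
    (p2 : 0 ≤ a₂) (q1 : b₁ ≤ R * a₁) (q2 : b₂ ≤ R * (R * a₂)) :
    2 * a₀ + 4 * b₁ + b₂ ≤ (2 + 4 * R + R ^ 2) * (a₀ + (a₁ + a₂)) := by
  have r0 : 0 ≤ (4 * R + R ^ 2) * a₀ := by positivity
  have r1 : 0 ≤ (2 + R ^ 2) * a₁ := by positivity
  have r2 : 0 ≤ (2 + 4 * R) * a₂ := by positivity
  linarith

/-- The interior cone estimate: mollified functions are bounded at the vertex of a cone in `Ω`
by the norm of `W^{2,n}(Ω)`. -/
lemma exists_abs_mollify_le (hn : 1 ≤ n) (hΩ : IsOpen Ω) (hb : Bornology.IsBounded Ω)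
    {B : Set (E n)} (hBm : MeasurableSet B) (hB0 : volume B ≠ 0) (hBt : volume B ≠ ⊤) {R : ℝ}
    (hR : ∀ y ∈ B, ‖y‖ ≤ R) :
    ∃ K : ℝ, 0 ≤ K ∧ ∀ w, MemW2 Ω n w → ∀ (φ : ContDiffBump (0 : E n)) (x : E n),
      (∀ y ∈ B, ∀ s ∈ Icc (0 : ℝ) 1, Metric.closedBall (x + s • y) φ.rOut ⊆ Ω) →
        |mollify φ Ω w x| ≤ K * normW2 Ω n w := by
  have hR0 : 0 ≤ R := by
    obtain ⟨y, hy⟩ := nonempty_of_measure_ne_zero hB0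
    exact (norm_nonneg y).trans (hR y hy)
  have hBpos : 0 < (volume B).toReal := ENNReal.toReal_pos hB0 hBt
  -- Indices for the function itself, its first and its second derivatives.
  let ι := Option (Fin n ⊕ Fin n × Fin n)
  let M : ℝ := 2 + 4 * R + R ^ 2
  have hM : 0 ≤ M := by positivity
  refine ⟨M * (Fintype.card ι * (volume B ^ (1 - 1 / (n : ℝ))).toReal) / (volume B).toReal,
    by positivity, fun w hw φ x hx => ?_⟩
  have : IsFiniteMeasure (volume.restrict Ω) := ⟨by simpa using hb.measure_lt_top⟩
  have h1n : (1 : ℝ≥0∞) ≤ n := by exact_mod_cast hn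
  let F : ι → E n → ℝ := fun k => k.elim w (Sum.elim (fun i => weakPartial Ω i w)
    fun q => weakPartial Ω q.2 (weakPartial Ω q.1 w))
  have hF : ∀ k, MemLp (F k) n (volume.restrict Ω) := by
    rintro (_ | _ | _)
    exacts [hw.2.1, hw.2.2.1 _, hw.2.2.2 _ _]
  obtain ⟨n1, n2, n3⟩ := lpNorm_le_normW2 hn hw
  have hN : ∀ k, lpNorm (F k) n (volume.restrict Ω) ≤ normW2 Ω n w := by
    rintro (_ | i | q)
    · exact n1
    · refine le_trans ?_ n2
      rw [← lpNorm_norm hw.memLp_weakGrad.1]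
      exact lpNorm_le_of_ae_le hw.memLp_weakGrad.norm
        (.of_forall fun x => PiLp.norm_apply_le (weakGrad Ω w x) i)
    · refine le_trans ?_ n3
      rw [← lpNorm_norm hw.memLp_weakHessVec.1]
      exact lpNorm_le_of_ae_le hw.memLp_weakHessVec.norm
        (.of_forall fun x => PiLp.norm_apply_le (weakHessVec Ω w x) (q.2, q.1))
  have hint k : IntegrableOn (F k) Ω := (hF k).integrable h1n
  have hcont k : Continuous (mollify φ Ω (F k)) :=
    continuous_mollify φ hΩ.measurableSet (hint k)
  have hcont0 : Continuous (mollify φ Ω w) := hcont none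
  have hcont1 i : Continuous (mollify φ Ω (weakPartial Ω i w)) := hcont (some (.inl i))
  have hcont2 i j : Continuous (mollify φ Ω (weakPartial Ω j (weakPartial Ω i w))) :=
    hcont (some (.inr (i, j)))
  have key : ∀ y ∈ B, |mollify φ Ω w x| ≤
      ∫ s in (0 : ℝ)..1, s * (M * ∑ k, |mollify φ Ω (F k) (x + s • y)|) := by
    intro y hy
    have hyi i : |y i| ≤ R := (PiLp.norm_apply_le y i).trans (hR y hy)
    have hrep := abs_le_integral_of_hasDerivAt
      (h := fun s : ℝ => mollify φ Ω w (x + s • y))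
      (h' := fun s => ∑ i, y i * mollify φ Ω (weakPartial Ω i w) (x + s • y))
      (h'' := fun s => ∑ i, y i *
        ∑ j, y j * mollify φ Ω (weakPartial Ω j (weakPartial Ω i w)) (x + s • y))
      (fun s hs => hasDerivAt_mollify_ray hΩ.measurableSet hw.isWeakPartial (hint none)
        (hx y hy s hs))
      (fun s hs => HasDerivAt.fun_sum fun i _ => (hasDerivAt_mollify_ray hΩ.measurableSet
        (hw.isWeakPartial₂ i) (hint (some (.inl i))) (hx y hy s hs)).const_mul _)
      (by fun_prop) (by fun_prop) (by fun_prop)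
    simp only [zero_smul, add_zero] at hrep
    refine hrep.trans (intervalIntegral.integral_mono_on zero_le_one
      (Continuous.intervalIntegrable (by fun_prop) _ _)
      (Continuous.intervalIntegrable (by fun_prop) _ _) fun s hs => ?_)
    refine mul_le_mul_of_nonneg_left ?_ hs.1
    have hsum : ∑ k, |mollify φ Ω (F k) (x + s • y)| = |mollify φ Ω w (x + s • y)|
        + (∑ i, |mollify φ Ω (weakPartial Ω i w) (x + s • y)|
        + ∑ i, ∑ j, |mollify φ Ω (weakPartial Ω j (weakPartial Ω i w)) (x + s • y)|) := by
      simp only [ι, F, Fintype.sum_option, Fintype.sum_sum_type, Fintype.sum_prod_type,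
        Option.elim_none, Option.elim_some, Sum.elim_inl, Sum.elim_inr]
    rw [hsum]
    set a₀ := |mollify φ Ω w (x + s • y)|
    set a₁ := ∑ i, |mollify φ Ω (weakPartial Ω i w) (x + s • y)|
    set a₂ := ∑ i, ∑ j, |mollify φ Ω (weakPartial Ω j (weakPartial Ω i w)) (x + s • y)|
    have p0 : 0 ≤ a₀ := abs_nonneg _
    have p1 : 0 ≤ a₁ := Finset.sum_nonneg fun _ _ => abs_nonneg _
    have p2 : 0 ≤ a₂ := Finset.sum_nonneg fun _ _ => Finset.sum_nonneg fun _ _ => abs_nonneg _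
    have hlin := abs_sum_coord_mul_le hyi
    have q1 : |∑ i, y i * mollify φ Ω (weakPartial Ω i w) (x + s • y)| ≤ R * a₁ := hlin _
    have q2 : |∑ i, y i *
        ∑ j, y j * mollify φ Ω (weakPartial Ω j (weakPartial Ω i w)) (x + s • y)|
        ≤ R * (R * a₂) := by
      refine (hlin _).trans (mul_le_mul_of_nonneg_left ?_ hR0)
      rw [Finset.mul_sum]
      exact Finset.sum_le_sum fun i _ => hlin _
    exact sobolev_weights_le hR0 p0 p1 p2 q1 q2
  have := mul_volume_le_of_le_integral_rays hn hΩ hb hBm hBt hF hN normW2_nonneg φ hM x key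
  rw [div_mul_eq_mul_div, le_div_iff₀ hBpos]
  linarith

/-- The uniform interior cone condition near a boundary point of a Lipschitz domain. -/
lemma IsBoundedLipschitz.exists_cone (hΩ : IsBoundedLipschitz Ω) {x₀ : E n}
    (hx₀ : x₀ ∈ frontier Ω) :
    ∃ ρ > (0 : ℝ), ∃ (p : E n) (δ : ℝ), 0 < δ ∧ ∀ x' ∈ frontier Ω, x' ∈ Metric.ball x₀ ρ →
      ∀ η > (0 : ℝ), ∃ (x : E n) (ε : ℝ), 0 < ε ∧ dist x x' < η ∧ ε < η ∧
        ∀ y ∈ Metric.ball p δ, ∀ s ∈ Icc (0 : ℝ) 1, Metric.closedBall (x + s • y) ε ⊆ Ω := by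
  obtain ⟨r, hr, ν, hν, K, γ, hγ, hgraph⟩ := hΩ.lipschitz_boundary x₀ hx₀
  have hK : (0 : ℝ) ≤ K := K.2
  have hk : 0 < 2 * (K : ℝ) + 2 := by positivity
  set ρ : ℝ := r / 8 with hρ
  have hρ0 : 0 < ρ := by positivity
  -- The cone has axis `ν`. Its opening `1 / (2 * K + 2)` is narrow enough for the slope `K`, and `ρ
  -- = r / 8` keeps it inside the chart.
  refine ⟨ρ, hρ0, ρ • ν, ρ / (2 * K + 2), by positivity, fun x' hx' hx'ρ η hη => ?_⟩
  have hx'r : x' ∈ Metric.ball x₀ r := Metric.ball_subset_ball (by linarith) hx'ρ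
  have hνν : ⟪ν, ν⟫_ℝ = 1 := by rw [real_inner_self_eq_norm_sq, hν]; norm_num
  -- A boundary point is a limit of points above the graph, so it lies on or above it.
  have hle : γ (x' - ⟪ν, x'⟫_ℝ • ν) ≤ ⟪ν, x'⟫_ℝ := by
    have hcl : x' ∈ closure (Ω ∩ Metric.ball x₀ r) := by
      rw [inter_comm]
      exact (Metric.isOpen_ball.inter_closure) ⟨hx'r, frontier_subset_closure hx'⟩
    have hclosed : IsClosed {x : E n | γ (x - ⟪ν, x⟫_ℝ • ν) ≤ ⟪ν, x⟫_ℝ} := by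
      have := hγ.continuous
      exact isClosed_le (by fun_prop) (by fun_prop)
    refine (closure_minimal (fun z hz => ?_) hclosed) hcl
    exact ((hgraph z hz.2).1 hz.1).le
  set τ : ℝ := min (η / 2) ρ with hτ
  have hτ0 : 0 < τ := lt_min (by linarith) hρ0
  have hτρ : τ ≤ ρ := min_le_right _ _
  have hτη : τ ≤ η / 2 := min_le_left _ _
  have hdiv : ∀ {a : ℝ}, 0 ≤ a → a / (2 * K + 2) ≤ a / 2 := fun {a} ha =>
    div_le_div_of_nonneg_left ha two_pos (by linarith)
  refine ⟨x' + τ • ν, τ / (2 * K + 2), by positivity, ?_, ?_, ?_⟩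
  · rw [dist_eq_norm, add_sub_cancel_left, norm_smul, hν, Real.norm_of_nonneg hτ0.le]
    linarith
  · linarith [hdiv hτ0.le]
  intro y hy s hs z hz
  -- Moving by `e` changes height and graph together by at most `(2 * K + 1) * ‖e‖`, which is less
  -- than the rise `τ + s * ρ`.
  obtain ⟨e, rfl⟩ : ∃ e, z = x' + ((τ + s * ρ) • ν + e) :=
    ⟨z - x' - (τ + s * ρ) • ν, by abel⟩
  have he : ‖e‖ ≤ (τ + s * ρ) / (2 * K + 2) := by
    have h1 : e = (x' + ((τ + s * ρ) • ν + e) - (x' + τ • ν + s • y)) + s • (y - ρ • ν) := by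
      rw [smul_sub, add_smul, mul_smul]; abel
    rw [h1]
    refine (norm_add_le _ _).trans ?_
    rw [mem_closedBall_iff_norm] at hz
    rw [mem_ball_iff_norm] at hy
    rw [norm_smul, Real.norm_of_nonneg hs.1, add_div, mul_div_assoc]
    exact add_le_add hz (mul_le_mul_of_nonneg_left hy.le hs.1)
  have hsρ0 : 0 ≤ s * ρ := mul_nonneg hs.1 hρ0.le
  have hsρ1 : s * ρ ≤ ρ := mul_le_of_le_one_left hρ0.le hs.2
  have hesmall : ‖e‖ ≤ (τ + s * ρ) / 2 := he.trans (hdiv (by linarith))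
  have hzball : x' + ((τ + s * ρ) • ν + e) ∈ Metric.ball x₀ r := by
    rw [mem_ball_iff_norm] at hx'ρ ⊢
    have : x' + ((τ + s * ρ) • ν + e) - x₀ = (x' - x₀) + ((τ + s * ρ) • ν + e) := by abel
    rw [this]
    have h2 : ‖(τ + s * ρ) • ν‖ = τ + s * ρ := by
      rw [norm_smul, hν, Real.norm_of_nonneg (by linarith), mul_one]
    have h3 := norm_add_le (x' - x₀) ((τ + s * ρ) • ν + e)
    have h4 := norm_add_le ((τ + s * ρ) • ν) e
    linarith
  rw [hgraph _ hzball]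
  have hin : ⟪ν, x' + ((τ + s * ρ) • ν + e)⟫_ℝ = ⟪ν, x'⟫_ℝ + (τ + s * ρ) + ⟪ν, e⟫_ℝ := by
    rw [inner_add_right, inner_add_right, inner_smul_right, hνν]; ring
  have hie : |⟪ν, e⟫_ℝ| ≤ ‖e‖ := by
    have := abs_real_inner_le_norm ν e
    rwa [hν, one_mul] at this
  have hdist : dist (γ (x' + ((τ + s * ρ) • ν + e) - ⟪ν, x' + ((τ + s * ρ) • ν + e)⟫_ℝ • ν))
      (γ (x' - ⟪ν, x'⟫_ℝ • ν)) ≤ K * (2 * ‖e‖) := by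
    refine (hγ.dist_le_mul _ _).trans (mul_le_mul_of_nonneg_left ?_ hK)
    rw [dist_eq_norm, hin]
    have : x' + ((τ + s * ρ) • ν + e) - (⟪ν, x'⟫_ℝ + (τ + s * ρ) + ⟪ν, e⟫_ℝ) • ν
        - (x' - ⟪ν, x'⟫_ℝ • ν) = e - ⟪ν, e⟫_ℝ • ν := by
      module
    rw [this]
    refine (norm_sub_le _ _).trans ?_
    rw [norm_smul, hν, mul_one, Real.norm_eq_abs]
    linarith
  rw [Real.dist_eq] at hdist
  have h5 := (abs_le.1 hdist).2
  have h6 := (abs_le.1 hie).1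
  rw [le_div_iff₀ hk] at he
  have h7 : 0 < τ + s * ρ := by linarith
  rcases eq_or_lt_of_le (norm_nonneg e) with h8 | h8
  · rw [← h8] at h5 h6
    linarith
  · linarith

/-- The boundary values of functions in `W^{2,n}(Ω)` that are continuous up to the boundary are
bounded by the Sobolev norm. -/
lemma IsBoundedLipschitz.exists_abs_le_normW2 (hn : 1 ≤ n) (hΩ : IsBoundedLipschitz Ω) :
    ∃ C : ℝ, 0 ≤ C ∧ ∀ w, MemW2 Ω n w → ContinuousOn w (closure Ω) → ∀ x ∈ frontier Ω,
      |w x| ≤ C * normW2 Ω n w := by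
  have hcomp : IsCompact (frontier Ω) :=
    hΩ.isBounded.isCompact_closure.of_isClosed_subset isClosed_frontier frontier_subset_closure
  have hΩm := hΩ.isOpen.measurableSet
  suffices h : ∃ C : ℝ, 0 ≤ C ∧ ∀ w, MemW2 Ω n w → ContinuousOn w (closure Ω) →
      ∀ x ∈ frontier Ω, x ∈ frontier Ω → |w x| ≤ C * normW2 Ω n w by
    obtain ⟨C, hC, h⟩ := h
    exact ⟨C, hC, fun w hw hc x hx => h w hw hc x hx hx⟩
  -- The property is local, constants add under unions, and each boundary point has a neighbourhood
  -- with a uniform cone.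
  refine hcomp.induction_on (p := fun S => ∃ C : ℝ, 0 ≤ C ∧ ∀ w, MemW2 Ω n w →
    ContinuousOn w (closure Ω) → ∀ x ∈ S, x ∈ frontier Ω → |w x| ≤ C * normW2 Ω n w) ?_ ?_ ?_ ?_
  · exact ⟨0, le_rfl, by simp⟩
  · rintro S T hST ⟨C, hC, h⟩
    exact ⟨C, hC, fun w hw hc x hx => h w hw hc x (hST hx)⟩
  · rintro S T ⟨C, hC, h⟩ ⟨D, hD, h'⟩
    refine ⟨C + D, add_nonneg hC hD, fun w hw hc x hx hxf => ?_⟩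
    have hN : 0 ≤ normW2 Ω n w := normW2_nonneg
    rw [add_mul]
    rcases hx with hx | hx
    · linarith [h w hw hc x hx hxf, mul_nonneg hD hN]
    · linarith [h' w hw hc x hx hxf, mul_nonneg hC hN]
  intro x₀ hx₀
  obtain ⟨ρ, hρ, p, δ, hδ, hcone⟩ := hΩ.exists_cone hx₀
  obtain ⟨K, hK, hbound⟩ := exists_abs_mollify_le hn hΩ.isOpen hΩ.isBounded
    (B := Metric.ball p δ) Metric.isOpen_ball.measurableSet
    (Metric.measure_ball_pos volume p hδ).ne' measure_ball_lt_top.ne (R := ‖p‖ + δ)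
    (fun y hy => by
      rw [mem_ball_iff_norm] at hy
      linarith [norm_le_norm_add_norm_sub' y p])
  refine ⟨_, mem_nhdsWithin_of_mem_nhds (Metric.ball_mem_nhds x₀ hρ), K, hK,
    fun w hw hc x' hx' hxf => le_of_forall_pos_le_add fun e he => ?_⟩
  obtain ⟨η, hη, hcontη⟩ := Metric.continuousWithinAt_iff.1
    (hc x' (frontier_subset_closure hxf)) e he
  obtain ⟨x, ε, hε, hxx', hεη, hball⟩ := hcone x' hxf hx' (η / 2) (by linarith)
  let φ : ContDiffBump (0 : E n) := ⟨ε / 2, ε, by linarith, by linarith⟩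
  have h1 := hbound w hw φ x hball
  have hsub : Metric.closedBall x ε ⊆ Ω := by
    simpa using hball p (Metric.mem_ball_self hδ) 0 ⟨le_rfl, zero_le_one⟩
  -- The kernel averages `w` over a ball in `Ω` within distance `η` of `x'`, where continuity up to
  -- the boundary applies.
  have h2 : dist (mollify φ Ω w x) (w x') ≤ e := by
    refine dist_convolution_le he.le φ.support_normed_eq.subset φ.nonneg_normed
      φ.integral_normed ((memLp_indicator_iff_restrict hΩm).2 hw.2.1).1 fun z hz => ?_
    have hzΩ : z ∈ Ω := hsub (Metric.ball_subset_closedBall hz)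
    rw [indicator_of_mem hzΩ]
    refine (hcontη (subset_closure hzΩ) ?_).le
    have h3 : dist z x < ε := hz
    linarith [dist_triangle z x x']
  rw [Real.dist_eq, abs_sub_comm] at h2
  linarith [abs_sub_abs_le_abs_sub (w x') (mollify φ Ω w x)]

end SupBound

/-! ### Discrete boundary maxima and the main estimate -/

section Discrete

variable {n : ℕ} {Ω : Set (E n)}

lemma supAbs_nonneg (S : Set (E n)) (w : E n → ℝ) : 0 ≤ supAbs S w :=
  Real.iSup_nonneg fun _ => abs_nonneg _

lemma supAbs_le {S : Set (E n)} {w : E n → ℝ} {t : ℝ} (ht : 0 ≤ t) (h : ∀ z ∈ S, |w z| ≤ t) :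
    supAbs S w ≤ t :=
  Real.iSup_le (fun z => h z z.2) ht

/-- Compactness provides boundedness, without which the real supremum would have the default value
`0`. -/
lemma abs_le_supAbs {S : Set (E n)} {w : E n → ℝ} (hS : IsCompact S) (hw : ContinuousOn w S)
    {z : E n} (hz : z ∈ S) : |w z| ≤ supAbs S w := by
  obtain ⟨M, hM⟩ := hS.exists_bound_of_continuousOn hw
  exact le_ciSup (f := fun z : S => |w z|) ⟨M, by rintro _ ⟨z, rfl⟩; exact hM z z.2⟩ ⟨z, hz⟩

lemma supAbs_congr {S : Set (E n)} {w w' : E n → ℝ} (h : ∀ z ∈ S, w z = w' z) :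
    supAbs S w = supAbs S w' :=
  iSup_congr fun z => by rw [h z z.2]

end Discrete

end NondivFEM

open NondivFEM in
theorem corollary3p4 (n : ℕ) (hn : 1 ≤ n) (Ω : Set (E n)) (hΩ : IsBoundedLipschitz Ω)
    (hΩ' : IsPolyhedral Ω) (lam Lam : ℝ) (hlam : 0 < lam) (hLam : lam ≤ Lam)
    (A : E n → Matrix (Fin n) (Fin n) ℝ) (b : E n → E n) (c : E n → ℝ)
    (hcoef : IsAdmissible Ω lam Lam A b c) (α : ℝ) (hα : 0 < α) :
    -- the constant does not depend on the discretization, on the data, or on the solution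
    ∃ C > (0 : ℝ), ∀ (S : ConformingSetting Ω) (f g u : E n → ℝ) (gh : ℕ → E n → ℝ),
      MemLp f n (volume.restrict Ω) → ContinuousOn g (frontier Ω) →
      -- exact boundary data in the discrete spaces
      (∀ j, gh j ∈ S.V j ∧ ∀ x ∈ frontier Ω, gh j x = g x) →
      IsStrongSolution Ω A b c f g u → MemW2 Ω n u →
      ∀ (j : ℕ) (uh : E n → ℝ) (t : ℝ),
        (uh, t) ∈ admissibleSet (S.V j) (S.L j) (gh j) →
        IsMinOn (Psi Ω A b c α f) (admissibleSet (S.V j) (S.L j) (gh j)) (uh, t) →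
        Psi Ω A b c α f (uh, t) = PsiTilde Ω A b c α f (S.L j) uh g ∧
        ∃ m : ℝ, IsLeast {r | ∃ v ∈ S.V j, r = normW2 Ω n (u - v) ^ n} m ∧
          Psi Ω A b c α f (uh, t) ≤ C * m := by
  obtain ⟨C₁, hC₁, hsup⟩ := hΩ.exists_abs_le_normW2 hn
  obtain ⟨C₂, hC₂, hop⟩ := exists_lpNorm_opL_le hn hΩ.isOpen hΩ.isBounded hcoef.continuousOn
    hcoef.drift hcoef.reaction
  -- The summand `1` only ensures positivity.
  refine ⟨α * C₁ ^ n + C₂ ^ n + 1, by positivity, ?_⟩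
  intro S f g u gh _ _ hgh hu huW j uh t ⟨huh, ht, hadm⟩ hmin
  have hn0 : n ≠ 0 := by omega
  have hV : ∀ v ∈ S.V j, MemW2 Ω n v := fun v hv =>
    (S.memW2 j v hv).mono_exponent hΩ.isBounded le_top
  have hLc : IsCompact (S.L j) := hΩ.isBounded.isCompact_closure.of_isClosed_subset
    (S.L_closed j) ((S.L_subset j).trans frontier_subset_closure)
  have hadmissible : ∀ v ∈ S.V j,
      (v, supAbs (S.L j) fun z => gh j z - v z) ∈ admissibleSet (S.V j) (S.L j) (gh j) := by
    refine fun v hv => ⟨hv, supAbs_nonneg (S.L j) fun z => gh j z - v z, fun z hz => abs_le.1 ?_⟩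
    exact abs_le_supAbs hLc (((S.continuousOn j _ (hgh j).1).sub (S.continuousOn j v hv)).mono
      ((S.L_subset j).trans frontier_subset_closure)) hz
  have hsupeq : ∀ v : E n → ℝ, (supAbs (S.L j) fun z => gh j z - v z)
      = supAbs (S.L j) fun z => g z - v z := fun v =>
    supAbs_congr fun z hz => by rw [(hgh j).2 z (S.L_subset j hz)]
  constructor
  -- Admissibility gives `PsiTilde ≤ Psi`; minimality against `uh` paired with its own boundary
  -- error gives the converse.
  · have hle : (supAbs (S.L j) fun z => gh j z - uh z) ≤ t :=
      supAbs_le ht fun z hz => abs_le.2 (hadm z hz)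
    have h1 := isMinOn_iff.1 hmin _ (hadmissible uh huh)
    refine le_antisymm ?_ ?_
    · simpa only [Psi, PsiTilde, hsupeq] using h1
    · rw [hsupeq] at hle
      simp only [Psi, PsiTilde]
      gcongr
      exact supAbs_nonneg _ _
  · have := S.finiteDimensional j
    obtain ⟨v, hv, hleast⟩ := exists_isLeast_normW2 hn hΩ.isOpen (S.V j) hV huW
    refine ⟨_, hleast, ?_⟩
    set N := normW2 Ω n (u - v) with hN
    have hN0 : 0 ≤ N := normW2_nonneg
    have hw : MemW2 Ω n (u - v) := (spaceW2 hΩ.isOpen n).sub_mem huW (hV v hv)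
    have hwc : ContinuousOn (u - v) (closure Ω) := hu.continuousOn.sub (S.continuousOn j v hv)
    have h1 : (supAbs (S.L j) fun z => gh j z - v z) ≤ C₁ * N := by
      refine supAbs_le (mul_nonneg hC₁ hN0) fun z hz => ?_
      have hz' := S.L_subset j hz
      rw [(hgh j).2 z hz', ← hu.boundary z hz']
      exact hsup _ hw hwc z hz'
    have h2 : lpNorm (fun x => f x - opL Ω A b c v x) n (volume.restrict Ω) ≤ C₂ * N := by
      refine le_trans (le_of_eq (lpNorm_congr_ae ?_)) (hop _ hw)
      filter_upwards [hu.equation, opL_sub_ae_eq (A := A) (b := b) (c := c) hΩ.isOpen huW (hV v hv)]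
        with x hx hx'
      rw [hx', hx]
    calc Psi Ω A b c α f (uh, t)
        ≤ Psi Ω A b c α f (v, supAbs (S.L j) fun z => gh j z - v z) :=
          isMinOn_iff.1 hmin _ (hadmissible v hv)
      _ ≤ α * (C₁ * N) ^ n + (C₂ * N) ^ n := by
          simp only [Psi]
          gcongr
          exacts [supAbs_nonneg _ _, lpNorm_nonneg]
      _ ≤ (α * C₁ ^ n + C₂ ^ n + 1) * N ^ n := by
          rw [mul_pow, mul_pow]
          linarith [pow_nonneg hN0 n]
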